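/- A complete first-order theory $T$ is \emph{strongly dependent} if there are no $m<\omega$ and formulas $\varphi_i(\bar x,\bar y_i)$ ($i<\omega$, $\ell g(\bar x)=m$, $\bar y_i$ finite) such that some model of $T$ contains tuples $\bar a^i_\alpha$ ($i,\alpha<\omega$) and $\bar c_\eta$ ($\eta\in{}^\omega\omega$) for which $\varphi_i(\bar c_\eta,\bar a^i_\alpha)$ holds if and only if $\eta(i)=\alpha$, for all $\eta,i,\alpha$. 1) Let $T$ be a complete first-order theory of an ordered abelian group in the language $\{+,-,0,<\}$ expanded by some individual constants and some unary predicates $P_i$ ($i\in I$, an arbitrary index set) which are interpreted as subgroups, and suppose that $T$ has elimination of quantifiers. Then $T$ is strongly dependent if and only if there are no $i_n\in I$ and $\iota_n\in\mathbb Z\setminus\{0\}$ ($n<\omega$) such that $(*)$ in some model $\mathfrak C$ of $T$ there are elements $b_{n,\ell}$ ($n,\ell<\omega$) with (a) $\iota_n(b_{n,\ell_2}-b_{n,\ell_1})\notin P^{\mathfrak C}_{i_n}$ for all $n$ and all $\ell_1<\ell_2$, and (b) for every $\eta\in{}^\omega\omega$ there is $c_\eta\in\mathfrak C$ such that $\iota_n(c_\eta-b_{n,\eta(n)})\in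 P^{\mathfrak C}_{i_n}$ for all $n<\omega$. 2) Let $M=(\mathbb Z,+,-,0,1,<,P_n)_{n<\omega}$, where $P_n=\{na:a\in\mathbb Z\}$. Then $\mathrm{Th}(M)$ has elimination of quantifiers and is strongly dependent; hence $\mathrm{Th}(\mathbb Z,+,-,0,<)$ is strongly dependent. -/

import Mathlib

open FirstOrder

universe u v w

namespace FirstOrder.Language

variable {L : Language.{u, v}}

/-- A theory has elimination of quantifiers if, modulo the theory, every formula is equivalent to
a quantifier-free formula in the same free variables. -/
def Theory.HasQE (T : L.Theory) : Prop :=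
  ∀ (n : ℕ) (φ : L.Formula (Fin n)), ∃ ψ : L.Formula (Fin n),
    BoundedFormula.IsQF ψ ∧ φ ⇔[T] ψ

/-- The sequence of formulas `φ i (x, y_i)`, `i : κ`, where `x` has length `m` and `y_i` has
length `k i`, witnesses `|κ| < κ_ict(T)`: the set
`{φ i (x_η, y^i_α) ^ (if η i = α) : η : κ → ℕ, α : ℕ, i : κ}` is consistent with `T`, i.e. it is
realised in some model of `T`. -/
def Theory.IsIctWitness (T : L.Theory) {κ : Type} (m : ℕ) (k : κ → ℕ)
    (φ : (i : κ) → L.Formula (Fin m ⊕ Fin (k i))) : Prop :=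
  ∃ (M : Theory.ModelType.{u, v, max u v} T)
    (a : (i : κ) → ℕ → Fin (k i) → M) (c : (κ → ℕ) → Fin m → M),
    ∀ (η : κ → ℕ) (i : κ) (α : ℕ),
      (φ i).Realize (Sum.elim (c η) (a i α)) ↔ η i = α

/-- `T` is strongly dependent: `ℵ₀ < κ_ict(T)` fails, i.e. no sequence of formulas of length `ω`
is a witness. -/
def Theory.StronglyDependent (T : L.Theory) : Prop :=
  ∀ (m : ℕ) (k : ℕ → ℕ) (φ : (i : ℕ) → L.Formula (Fin m ⊕ Fin (k i))),
    ¬ T.IsIctWitness m k φ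

end FirstOrder.Language

/-- Function symbols: `0`, `-`, `+`, and an individual constant for each element of `C`. -/
inductive OagFunctions (C : Type u) : ℕ → Type u
  | zero : OagFunctions C 0
  | const (c : C) : OagFunctions C 0
  | neg : OagFunctions C 1
  | add : OagFunctions C 2

/-- Relation symbols: `<`, and a unary predicate for each element of `I`. -/
inductive OagRelations (I : Type v) : ℕ → Type v
  | lt : OagRelations I 2
  | pred (i : I) : OagRelations I 1

/-- The language of ordered abelian groups `{+, -, 0, <}` expanded by individual constants indexed
by `C` and unary predicates indexed by `I`. -/
def oagLanguage (C : Type u) (I : Type v) : FirstOrder.Language.{u, v} :=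
  ⟨OagFunctions C, OagRelations I⟩

/-- An ordered abelian group with distinguished elements indexed by `C` and distinguished subgroups
indexed by `I`. -/
structure ExpandedOAG (C : Type u) (I : Type v) where
  /-- The underlying set. -/
  carrier : Type w
  [addCommGroup : AddCommGroup carrier]
  [linearOrder : LinearOrder carrier]
  [isOrderedAddMonoid : IsOrderedAddMonoid carrier]
  /-- The distinguished elements. -/
  const : C → carrier
  /-- The distinguished subgroups. -/
  pred : I → AddSubgroup carrier

namespace ExpandedOAG

variable {C : Type u} {I : Type v}

instance : CoeSort (ExpandedOAG.{u, v, w} C I) (Type w) := ⟨carrier⟩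

attribute [instance] addCommGroup linearOrder isOrderedAddMonoid

/-- An expanded ordered abelian group as a first-order structure. -/
instance toStructure (G : ExpandedOAG.{u, v, w} C I) : (oagLanguage C I).Structure G where
  funMap := fun f x => match f, x with
    | OagFunctions.zero, _ => 0
    | OagFunctions.const c, _ => G.const c
    | OagFunctions.neg, x => - x 0
    | OagFunctions.add, x => x 0 + x 1
  RelMap := fun r x => match r, x with
    | OagRelations.lt, x => x 0 < x 1
    | OagRelations.pred i, x => x 0 ∈ G.pred i

/-- The complete first-order theory of an expanded ordered abelian group. -/
def theory (G : ExpandedOAG.{u, v, w} C I) : (oagLanguage C I).Theory :=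
  (oagLanguage C I).completeTheory G

end ExpandedOAG

/-- In some model of `T` there are elements `b n ℓ` such that for each `n` the elements
`ι n • b n ℓ` are pairwise incongruent modulo the subgroup `P_{i n}`, while for every `η : ℕ → ℕ`
some `c` satisfies `ι n • c ≡ ι n • b n (η n)` modulo `P_{i n}` for all `n`. -/
def RealizesSubgroupPattern {C : Type u} {I : Type v} (T : (oagLanguage C I).Theory)
    (i : ℕ → I) (ι : ℕ → ℤ) : Prop :=
  ∃ G : ExpandedOAG.{u, v, max u v} C I, (G : Type (max u v)) ⊨ T ∧
    ∃ b : ℕ → ℕ → G,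
      (∀ n ℓ₁ ℓ₂ : ℕ, ℓ₁ < ℓ₂ → ι n • (b n ℓ₂ - b n ℓ₁) ∉ G.pred (i n)) ∧
      (∀ η : ℕ → ℕ, ∃ c : G, ∀ n : ℕ, ι n • (c - b n (η n)) ∈ G.pred (i n))

/-- The structure `(ℤ, +, -, 0, 1, <, P_n)` where `P_n = {n * a : a ∈ ℤ}`. -/
def intWithMultiples : ExpandedOAG.{0, 0, 0} Unit ℕ where
  carrier := ℤ
  const := fun _ => 1
  pred := fun n => AddSubgroup.zmultiples (n : ℤ)

/-- The structure `(ℤ, +, -, 0, <)`. -/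
def intOrderedGroup : ExpandedOAG.{0, 0, 0} Empty Empty where
  carrier := ℤ
  const := Empty.elim
  pred := fun i => i.elim

/-! ### Completeness, compactness and ict-patterns -/

namespace FirstOrder.Language

variable {L : Language.{u, v}}

/-! A subgroup pattern is an ict-pattern for the formulas `ι_n (x - y) ∈ P_{i_n}`. For the converse,
quantifier elimination turns each formula of an ict-pattern in `m` variables into a Boolean
combination of atoms `0 < t x + u α` and `t x + u α ∈ P_j`, where `t` is an integral linear form and
the sequence `u` depends only on the parameters. Ramsey thinning makes each `u` either constant or
nowhere constant (modulo `P_j` for the second kind). A tuple isolating one position then has `t x`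
in the cut or coset that marks this position for a nowhere constant atom (`exists_spread_atoms`). A
polarized Ramsey argument and a limit along an ultrafilter fix one such atom for each row
(`exists_colors_on_boxes`). A linear relation between the forms of cut rows is contradictory, so at
most `m` rows are of that kind (`finite_order_rows`). The coset rows make the subgroups `{x | t_n x
∈ P_{j_n}}` of `G^m` independent: each has infinite index over finite intersections of the others.

It remains to descend to one variable. If no sequence of subgroups `{y | ι_n y ∈ P_{i_n}}` of `G`
with all `ι_n ≠ 0` is independent, then arbitrarily late subgroups of `G^(m+1)` are dependent on the
kernel of the projection to `G^m`, and intersections over disjoint finite blocks have independent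
images (`IndepSubgroups.exists_map`). These images are definable, hence give an ict-pattern in `m`
variables, and induction applies; with no variables there is no pattern.

For `ℤ`, quantifier elimination is Cooper's argument for Presburger arithmetic. In every model `P_k`
has finite index for `k ≠ 0` and `P_0` is trivial, which excludes subgroup patterns. Strong
dependence then passes to the reduct. -/

theorem Formula.realize_exClosure_iff {V : Type*} [DecidableEq V] (φ : L.Formula V) (K : Type*)
    [L.Structure K] [Nonempty K] : φ.exClosure.Realize K ↔ ∃ v : V → K, φ.Realize v := by
  rw [← Formula.exists_realize_equivSentence_iff_realize_exClosure]
  refine exists_congr fun v => ?_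
  rw [← Formula.realize_equivSentence_symm, _root_.Equiv.symm_apply_apply]

/-- A formula satisfiable in one model of a complete theory is satisfiable in every model. -/
theorem Theory.IsComplete.exists_realize {T : L.Theory} (hT : T.IsComplete) {M N : Type*}
    [L.Structure M] [L.Structure N] [M ⊨ T] [N ⊨ T] [Nonempty M] [Nonempty N] {V : Type*}
    {φ : L.Formula V} (h : ∃ v : V → M, φ.Realize v) : ∃ v : V → N, φ.Realize v := by
  classical
  rw [← Formula.realize_exClosure_iff] at h ⊢
  exact (hT.realize_sentence_iff _ N).2 ((hT.realize_sentence_iff _ M).1 h)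

theorem Theory.IsComplete.forall_realize {T : L.Theory} (hT : T.IsComplete) {M N : Type*}
    [L.Structure M] [L.Structure N] [M ⊨ T] [N ⊨ T] [Nonempty M] [Nonempty N] {V : Type*}
    {φ : L.Formula V} (h : ∀ v : V → M, φ.Realize v) (v : V → N) : φ.Realize v := by
  by_contra hv
  obtain ⟨w, hw⟩ := hT.exists_realize (M := N) (N := M) (φ := φ.not) ⟨v, hv⟩
  exact hw (h w)

/-- Compactness for families of formulas in possibly infinitely many variables. -/
theorem Theory.exists_realize_of_finite {T : L.Theory} {V : Type} {ι : Type*}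
    (σ : ι → L.Formula V) (N : Type w) [L.Structure N] [N ⊨ T] [Nonempty N]
    (h : ∀ F : Finset ι, ∃ v : V → N, ∀ i ∈ F, (σ i).Realize v) :
    ∃ (M : Theory.ModelType.{u, v, max u v} T) (v : V → M), ∀ i, (σ i).Realize v := by
  classical
  let S : ι → L[[V]].Theory := fun i =>
    (L.lhomWithConstants V).onTheory T ∪ {Formula.equivSentence (σ i)}
  -- The index `none` keeps `T` in the union even when `ι` is empty.
  let S0 : Option ι → L[[V]].Theory := fun o => o.elim ((L.lhomWithConstants V).onTheory T) S
  have hS : Theory.IsSatisfiable (⋃ i, S0 i) := by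
    rw [isSatisfiable_iUnion_iff_isSatisfiable_iUnion_finset]
    intro s
    obtain ⟨v, hv⟩ := h s.eraseNone
    let : (constantsOn V).Structure N := constantsOn.structure v
    have hTN : N ⊨ (L.lhomWithConstants V).onTheory T := (LHom.onTheory_model _ T).2 inferInstance
    have : N ⊨ (⋃ i ∈ s, S0 i : L[[V]].Theory) := by
      rw [Theory.model_iff]
      intro φ hφ
      simp only [Set.mem_iUnion] at hφ
      obtain ⟨o, ho, hφ⟩ := hφ
      cases o with
      | none => exact hTN.realize_of_mem φ hφ
      | some i =>
        rcases hφ with hφ | hφ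
        · exact hTN.realize_of_mem φ hφ
        · rw [Set.mem_singleton_iff] at hφ
          subst hφ
          have := hv i (by simpa using ho)
          rw [Formula.realize_equivSentence]
          exact this
    exact Model.isSatisfiable N
  obtain ⟨M⟩ := hS
  have hsub : (L.lhomWithConstants V).onTheory T ⊆ ⋃ i, S0 i := Set.subset_iUnion S0 none
  -- Realising the complete theory of `M` as a type turns the new constants back into an assignment
  -- of the variables.
  let p : T.CompleteType V :=
    { toTheory := L[[V]].completeTheory M
      subset' := fun φ hφ => M.is_model.realize_of_mem φ (hsub hφ)
      isMaximal' := completeTheory.isMaximal _ _ }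
  obtain ⟨M', v, hv⟩ := Theory.exists_modelType_is_realized_in T p
  refine ⟨M', v, fun i => ?_⟩
  rw [← CompleteType.formula_mem_typeOf (T := T), hv]
  exact M.is_model.realize_of_mem _ (Set.mem_iUnion.2 ⟨some i, Or.inr rfl⟩)

/-- Variables for an ict-pattern: the coordinates of the tuples `c η` and `a i α`. -/
abbrev IctVar (κ : Type) (m : ℕ) (k : κ → ℕ) : Type :=
  ((κ → ℕ) × Fin m) ⊕ (Σ i : κ, ℕ × Fin (k i))

open Classical in
/-- The formula `φ i (c η, a i α) ^ (if η i = α)`. -/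
noncomputable def ictFormula {κ : Type} {m : ℕ} {k : κ → ℕ}
    (φ : (i : κ) → L.Formula (Fin m ⊕ Fin (k i))) (p : (κ → ℕ) × κ × ℕ) :
    L.Formula (IctVar κ m k) :=
  let ψ := (φ p.2.1).relabel (Sum.map (fun l => (p.1, l)) (fun l => ⟨p.2.1, (p.2.2, l)⟩))
  if p.1 p.2.1 = p.2.2 then ψ else ψ.not

theorem realize_ictFormula {κ : Type} {m : ℕ} {k : κ → ℕ}
    (φ : (i : κ) → L.Formula (Fin m ⊕ Fin (k i))) (p : (κ → ℕ) × κ × ℕ) {M : Type*}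
    [L.Structure M] (v : IctVar κ m k → M) :
    (ictFormula φ p).Realize v ↔ ((φ p.2.1).Realize (Sum.elim (fun l => v (Sum.inl (p.1, l)))
      (fun l => v (Sum.inr ⟨p.2.1, (p.2.2, l)⟩))) ↔ p.1 p.2.1 = p.2.2) := by
  have h : v ∘ Sum.map (fun l => (p.1, l)) (fun l => ⟨p.2.1, (p.2.2, l)⟩) =
      Sum.elim (fun l => v (Sum.inl (p.1, l))) (fun l => v (Sum.inr ⟨p.2.1, (p.2.2, l)⟩)) := by
    funext x
    cases x <;> rfl
  by_cases hp : p.1 p.2.1 = p.2.2 <;> simp [ictFormula, hp, Formula.realize_relabel, h]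

/-- By compactness, it suffices to realise the finite parts of an ict-pattern. -/
theorem Theory.isIctWitness_of_finite {T : L.Theory} {κ : Type} {m : ℕ} {k : κ → ℕ}
    {φ : (i : κ) → L.Formula (Fin m ⊕ Fin (k i))}
    (N : Type w) [L.Structure N] [N ⊨ T] [Nonempty N]
    (h : ∀ F : Finset ((κ → ℕ) × κ × ℕ),
      ∃ (a : (i : κ) → ℕ → Fin (k i) → N) (c : (κ → ℕ) → Fin m → N),
        ∀ p ∈ F, (φ p.2.1).Realize (Sum.elim (c p.1) (a p.2.1 p.2.2)) ↔ p.1 p.2.1 = p.2.2) :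
    T.IsIctWitness m k φ := by
  obtain ⟨M, v, hv⟩ := Theory.exists_realize_of_finite (T := T) (ictFormula φ) N fun F => by
    obtain ⟨a, c, hac⟩ := h F
    exact ⟨Sum.elim (fun x => c x.1 x.2) (fun x => a x.1 x.2.1 x.2.2), fun p hp =>
      (realize_ictFormula φ p _).2 (hac p hp)⟩
  exact ⟨M, fun i α l => v (.inr ⟨i, (α, l)⟩), fun η l => v (.inl (η, l)), fun η i α =>
    (realize_ictFormula φ (η, i, α) v).1 (hv (η, i, α))⟩

/-- The finite parts of an ict-pattern for a complete theory are realised in every model. -/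
theorem Theory.IsComplete.exists_finite_ictPattern {T : L.Theory} (hT : T.IsComplete) {κ : Type}
    {m : ℕ} {k : κ → ℕ} {φ : (i : κ) → L.Formula (Fin m ⊕ Fin (k i))} (h : T.IsIctWitness m k φ)
    (N : Type w) [L.Structure N] [N ⊨ T] [Nonempty N] (F : Finset ((κ → ℕ) × κ × ℕ)) :
    ∃ (a : (i : κ) → ℕ → Fin (k i) → N) (c : (κ → ℕ) → Fin m → N),
      ∀ p ∈ F, (φ p.2.1).Realize (Sum.elim (c p.1) (a p.2.1 p.2.2)) ↔ p.1 p.2.1 = p.2.2 := by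
  obtain ⟨M, a, c, hac⟩ := h
  obtain ⟨v, hv⟩ := hT.exists_realize (M := M) (N := N)
    (φ := Formula.iInf fun p : F => ictFormula φ p)
    ⟨Sum.elim (fun x => c x.1 x.2) (fun x => a x.1 x.2.1 x.2.2), Formula.realize_iInf.2 fun p =>
      (realize_ictFormula φ p _).2 (hac p.1.1 p.1.2.1 p.1.2.2)⟩
  exact ⟨fun i α l => v (.inr ⟨i, (α, l)⟩), fun η l => v (.inl (η, l)), fun p hp =>
    (realize_ictFormula φ p v).1 (Formula.realize_iInf.1 hv ⟨p, hp⟩)⟩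

end FirstOrder.Language

/-! ### Terms as affine functions -/

namespace ExpandedOAG
open FirstOrder.Language

section Terms

variable {C : Type u} {I : Type v} {V : Type*}

/-- The symbol `+`. -/
def addSymbol (C : Type u) (I : Type v) : (oagLanguage C I).Functions 2 := OagFunctions.add

/-- The symbol `-`. -/
def negSymbol (C : Type u) (I : Type v) : (oagLanguage C I).Functions 1 := OagFunctions.neg

/-- The symbol `0`. -/
def zeroSymbol (C : Type u) (I : Type v) : (oagLanguage C I).Functions 0 := OagFunctions.zero

/-- The symbol of an individual constant. -/
def constSymbol (I : Type v) (c : C) : (oagLanguage C I).Functions 0 := OagFunctions.const c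

/-- The symbol `<`. -/
def ltSymbol (C : Type u) (I : Type v) : (oagLanguage C I).Relations 2 := OagRelations.lt

/-- The symbol of a unary predicate. -/
def predSymbol (C : Type u) (i : I) : (oagLanguage C I).Relations 1 := OagRelations.pred i

/-- The term `s + t`. -/
def addTerm (s t : (oagLanguage C I).Term V) : (oagLanguage C I).Term V :=
  Term.func (addSymbol C I) ![s, t]

/-- The term `-t`. -/
def negTerm (t : (oagLanguage C I).Term V) : (oagLanguage C I).Term V :=
  Term.func (negSymbol C I) ![t]

/-- The term `0`. -/
def zeroTerm : (oagLanguage C I).Term V :=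
  Term.func (zeroSymbol C I) ![]

/-- The term naming a distinguished element. -/
def constTerm (c : C) : (oagLanguage C I).Term V :=
  Term.func (constSymbol I c) ![]

/-- The formula `s < t`. -/
def ltFormula (s t : (oagLanguage C I).Term V) : (oagLanguage C I).Formula V :=
  Relations.formula (ltSymbol C I) ![s, t]

/-- The formula `P_i t`. -/
def predFormula (i : I) (t : (oagLanguage C I).Term V) : (oagLanguage C I).Formula V :=
  Relations.formula (predSymbol C i) ![t]

section Realize

variable {M : Type*} [(oagLanguage C I).Structure M] (x : V → M)

theorem realize_addTerm' (s t : (oagLanguage C I).Term V) : (addTerm s t).realize x =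
    Structure.funMap (addSymbol C I) ![s.realize x, t.realize x] := by
  rw [addTerm, Term.realize_func]
  congr 1
  funext i
  fin_cases i <;> rfl

theorem realize_negTerm' (t : (oagLanguage C I).Term V) : (negTerm t).realize x =
    Structure.funMap (negSymbol C I) ![t.realize x] := by
  rw [negTerm, Term.realize_func]
  congr 1
  funext i
  fin_cases i; rfl

theorem realize_zeroTerm' : (zeroTerm : (oagLanguage C I).Term V).realize x =
    Structure.funMap (zeroSymbol C I) ![] := by
  rw [zeroTerm, Term.realize_func]
  congr 1
  funext i
  exact i.elim0

theorem realize_ltFormula' (s t : (oagLanguage C I).Term V) : (ltFormula s t).Realize x ↔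
    Structure.RelMap (ltSymbol C I)
      ![s.realize x, t.realize x] := by
  rw [ltFormula, Formula.realize_rel]
  refine iff_of_eq (congrArg _ ?_)
  funext i
  fin_cases i <;> rfl

theorem realize_predFormula' (i : I) (t : (oagLanguage C I).Term V) :
    (predFormula i t).Realize x ↔
      Structure.RelMap (predSymbol C i) ![t.realize x] := by
  rw [predFormula, Formula.realize_rel]
  refine iff_of_eq (congrArg _ ?_)
  funext i
  fin_cases i; rfl

end Realize

variable (G : ExpandedOAG.{u, v, w} C I) (x : V → G)

@[simp] theorem realize_addTerm (s t : (oagLanguage C I).Term V) :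
    (addTerm s t).realize x = s.realize x + t.realize x := realize_addTerm' x s t

@[simp] theorem realize_negTerm (t : (oagLanguage C I).Term V) :
    (negTerm t).realize x = - t.realize x := realize_negTerm' x t

@[simp] theorem realize_zeroTerm :
    (zeroTerm : (oagLanguage C I).Term V).realize x = 0 := realize_zeroTerm' x

@[simp] theorem realize_ltFormula (s t : (oagLanguage C I).Term V) :
    (ltFormula s t).Realize x ↔ s.realize x < t.realize x := realize_ltFormula' x s t

@[simp] theorem realize_predFormula (i : I) (t : (oagLanguage C I).Term V) :
    (predFormula i t).Realize x ↔ t.realize x ∈ G.pred i := realize_predFormula' x i t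

theorem exists_nsmulTerm (n : ℕ) (t : (oagLanguage C I).Term V) :
    ∃ s : (oagLanguage C I).Term V, ∀ (G : ExpandedOAG.{u, v, w} C I) (x : V → G),
      s.realize x = n • t.realize x := by
  induction n with
  | zero => exact ⟨zeroTerm, by simp⟩
  | succ n ih =>
    obtain ⟨s, hs⟩ := ih
    exact ⟨addTerm s t, fun G x => by rw [realize_addTerm, hs, succ_nsmul]⟩

theorem exists_zsmulTerm (n : ℤ) (t : (oagLanguage C I).Term V) :
    ∃ s : (oagLanguage C I).Term V, ∀ (G : ExpandedOAG.{u, v, w} C I) (x : V → G),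
      s.realize x = n • t.realize x := by
  obtain ⟨s, hs⟩ := exists_nsmulTerm.{u, v, w} n.natAbs t
  rcases Int.natAbs_eq n with h | h
  · exact ⟨s, fun G x => by rw [hs, h, natCast_zsmul, Int.natAbs_natCast]⟩
  · exact ⟨negTerm s, fun G x => by
      rw [realize_negTerm, hs, h, neg_smul, natCast_zsmul, Int.natAbs_neg, Int.natAbs_natCast]⟩

theorem exists_sumTerm [Fintype V] (a : V → ℤ) :
    ∃ s : (oagLanguage C I).Term V, ∀ (G : ExpandedOAG.{u, v, w} C I) (x : V → G),
      s.realize x = ∑ i, a i • x i := by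
  classical
  suffices H : ∀ F : Finset V, ∃ s : (oagLanguage C I).Term V,
      ∀ (G : ExpandedOAG.{u, v, w} C I) (x : V → G), s.realize x = ∑ i ∈ F, a i • x i from
    H Finset.univ
  intro F
  induction F using Finset.induction_on with
  | empty => exact ⟨zeroTerm, by simp⟩
  | insert i F hi ih =>
    obtain ⟨s, hs⟩ := ih
    obtain ⟨t, ht⟩ := exists_zsmulTerm.{u, v, w} (a i) (Term.var i : (oagLanguage C I).Term V)
    exact ⟨addTerm t s, fun G x => by
      rw [realize_addTerm, hs, ht, Finset.sum_insert hi, Term.realize_var]⟩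

/-- Every term is an affine function with integer coefficients. -/
theorem exists_affine_eq_realize [Fintype V] (t : (oagLanguage C I).Term V) :
    ∃ (a : V → ℤ) (c : G), ∀ x : V → G, t.realize x = ∑ i, a i • x i + c := by
  classical
  induction t with
  | var i => exact ⟨Pi.single i 1, 0, fun x => by simp [Pi.single_apply]⟩
  | @func n f ts ih =>
    match n, f, ts, ih with
    | _, OagFunctions.zero, ts, ih => exact ⟨0, 0, fun x => by simp; rfl⟩
    | _, OagFunctions.const c, ts, ih => exact ⟨0, G.const c, fun x => by simp; rfl⟩
    | _, OagFunctions.neg, ts, ih =>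
      obtain ⟨a, c, h⟩ := ih 0
      refine ⟨-a, -c, fun x => ?_⟩
      change - (ts 0).realize x = _
      rw [h]
      simp [Finset.sum_neg_distrib, add_comm]
    | _, OagFunctions.add, ts, ih =>
      obtain ⟨a, c, h⟩ := ih 0
      obtain ⟨a', c', h'⟩ := ih 1
      refine ⟨a + a', c + c', fun x => ?_⟩
      change (ts 0).realize x + (ts 1).realize x = _
      rw [h, h']
      simp only [Pi.add_apply, add_smul, Finset.sum_add_distrib]
      abel

end Terms

/-! ### Models of the theory are expanded ordered groups -/

section Models

variable {C : Type u} {I : Type v}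

/-- A model of a complete theory of expanded ordered abelian groups is one. -/
theorem exists_toStructure_eq {T : (oagLanguage C I).Theory} (hT : T.IsComplete)
    (G : ExpandedOAG.{u, v, w} C I) (hG : (G : Type w) ⊨ T) {M : Type*}
    [S : (oagLanguage C I).Structure M] [M ⊨ T] [Nonempty M] :
    ∃ G' : ExpandedOAG.{u, v, _} C I,
      ∀ p : (K : Type _) → (oagLanguage C I).Structure K → Prop, p M S → p G' G'.toStructure := by
  classical
  let v0 {n : ℕ} (i : Fin n) : (oagLanguage C I).Term (Fin n) := Term.var i
  -- The axioms of ordered abelian groups with subgroups are universal, so completeness carries each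
  -- of them from `G` to `M`.
  have tr : ∀ {n : ℕ} (φ : (oagLanguage C I).Formula (Fin n)), (∀ x : Fin n → G, φ.Realize x) →
      ∀ x : Fin n → M, φ.Realize x := fun φ h x => hT.forall_realize (M := G) (N := M) h x
  let add (x y : M) : M := Structure.funMap (addSymbol C I) ![x, y]
  let neg (x : M) : M := Structure.funMap (negSymbol C I) ![x]
  let zero : M := Structure.funMap (zeroSymbol C I) ![]
  let lt (x y : M) : Prop := Structure.RelMap (ltSymbol C I) ![x, y]
  let P (i : I) (x : M) : Prop :=
    Structure.RelMap (predSymbol C i) ![x]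
  have ra : ∀ {n : ℕ} (x : Fin n → M) s t, (addTerm s t).realize x =
    add (s.realize x) (t.realize x) := fun x s t => realize_addTerm' x s t
  have rn : ∀ {n : ℕ} (x : Fin n → M) t, (negTerm t).realize x = neg (t.realize x) :=
    fun x t => realize_negTerm' x t
  have rz : ∀ {n : ℕ} (x : Fin n → M), (zeroTerm : (oagLanguage C I).Term (Fin n)).realize x =
    zero := fun x => realize_zeroTerm' x
  have rl : ∀ {n : ℕ} (x : Fin n → M) s t, (ltFormula s t).Realize x ↔
    lt (s.realize x) (t.realize x) := fun x s t => realize_ltFormula' x s t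
  have rp : ∀ {n : ℕ} (x : Fin n → M) i t, (predFormula i t).Realize x ↔
    P i (t.realize x) := fun x i t => realize_predFormula' x i t
  have add_assoc' : ∀ x y z, add (add x y) z = add x (add y z) := fun x y z => by
    simpa [ra, v0] using tr ((addTerm (addTerm (v0 0) (v0 1)) (v0 2)).equal
      (addTerm (v0 0) (addTerm (v0 1) (v0 2)))) (by simp [add_assoc]) ![x, y, z]
  have add_comm' : ∀ x y, add x y = add y x := fun x y => by
    simpa [ra, v0] using tr ((addTerm (v0 0) (v0 1)).equal (addTerm (v0 1) (v0 0)))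
      (by simp [add_comm]) ![x, y]
  have zero_add' : ∀ x, add zero x = x := fun x => by
    simpa [ra, rz, v0] using tr ((addTerm zeroTerm (v0 0)).equal (v0 0)) (by simp) ![x]
  have neg_add' : ∀ x, add (neg x) x = zero := fun x => by
    simpa [ra, rz, rn, v0] using tr ((addTerm (negTerm (v0 0)) (v0 0)).equal zeroTerm)
      (by simp) ![x]
  have lt_irrefl' : ∀ x, ¬ lt x x := fun x => by
    simpa [rl, v0] using tr (ltFormula (v0 0) (v0 0)).not (by simp) ![x]
  have lt_trans' : ∀ x y z, lt x y → lt y z → lt x z := fun x y z => by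
    simpa [rl, v0] using tr ((ltFormula (v0 0) (v0 1)).imp ((ltFormula (v0 1) (v0 2)).imp
      (ltFormula (v0 0) (v0 2)))) (by simpa [v0] using fun x => lt_trans) ![x, y, z]
  have lt_total' : ∀ x y, ¬ lt x y → ¬ lt y x → x = y := fun x y => by
    simpa [rl, v0] using tr ((ltFormula (v0 0) (v0 1)).not.imp ((ltFormula (v0 1) (v0 0)).not.imp
      ((v0 0).equal (v0 1)))) (by simpa [v0] using fun x h h' => le_antisymm h' h) ![x, y]
  have add_lt' : ∀ x y z, lt x y → lt (add z x) (add z y) := fun x y z => by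
    simpa [rl, ra, v0] using tr ((ltFormula (v0 0) (v0 1)).imp
      (ltFormula (addTerm (v0 2) (v0 0)) (addTerm (v0 2) (v0 1)))) (by simp [v0]) ![x, y, z]
  have P_zero : ∀ i, P i zero := fun i => by
    simpa [rp, rz] using tr (n := 0) (predFormula i zeroTerm) (by simp) ![]
  have P_add : ∀ i x y, P i x → P i y → P i (add x y) := fun i x y => by
    simpa [rp, ra, v0] using tr ((predFormula i (v0 0)).imp ((predFormula i (v0 1)).imp
      (predFormula i (addTerm (v0 0) (v0 1))))) (by simpa [v0] using fun x => add_mem) ![x, y]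
  have P_neg : ∀ i x, P i x → P i (neg x) := fun i x => by
    simpa [rp, rn, v0] using tr ((predFormula i (v0 0)).imp (predFormula i (negTerm (v0 0))))
      (by simp [v0]) ![x]
  let grp : AddCommGroup M :=
    let _ : Add M := ⟨add⟩
    let _ : Zero M := ⟨zero⟩
    let _ : Neg M := ⟨neg⟩
    { AddGroup.ofLeftAxioms add_assoc' zero_add' neg_add' with add_comm := add_comm' }
  let ord : LinearOrder M :=
    { le := fun x y => ¬ lt y x, lt := lt
      le_refl := lt_irrefl'
      le_trans := fun x y z h h' h'' => by
        by_cases hxy : lt x y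
        · exact h' (lt_trans' _ _ _ h'' hxy)
        · exact h' (lt_total' x y hxy h ▸ h'')
      lt_iff_le_not_ge := fun x y =>
        ⟨fun h => ⟨fun h' => lt_irrefl' _ (lt_trans' _ _ _ h h'), fun h' => h' h⟩,
          fun h => not_not.1 h.2⟩
      le_antisymm := fun x y h h' => lt_total' x y h' h
      le_total := fun x y => by
        by_contra h
        push Not at h
        exact lt_irrefl' _ (lt_trans' _ _ _ h.1 h.2)
      toDecidableLE := Classical.decRel _ }
  have oam : IsOrderedAddMonoid M :=
    { add_le_add_left := fun x y h z h' => by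
        have key : ∀ a, add (neg z) (add a z) = a := fun a => by
          rw [add_comm' a z, ← add_assoc', neg_add', zero_add']
        have := add_lt' (add y z) (add x z) (neg z) h'
        rw [key, key] at this
        exact h this }
  -- The carrier is `M` itself and the two structures on it are equal, so every property `p` carries
  -- over without transport between types.
  refine ⟨{ carrier := M, addCommGroup := grp, linearOrder := ord, isOrderedAddMonoid := oam
            const := fun c => Structure.funMap (constSymbol I c) ![]
            pred := fun i => { carrier := {x | P i x}, zero_mem' := P_zero i
                               add_mem' := fun hx hy => P_add i _ _ hx hy
                               neg_mem' := fun hx => P_neg i _ hx } }, fun p hp => ?_⟩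
  have e1 : ∀ x : Fin 1 → M, ![x 0] = x := fun x => by funext i; fin_cases i; rfl
  have e2 : ∀ x : Fin 2 → M, ![x 0, x 1] = x := fun x => by funext i; fin_cases i <;> rfl
  refine (congrArg (p M) (Structure.ext ?_ ?_)).mpr hp
  · funext n f x
    match n, f, x with
    | _, OagFunctions.zero, x => exact congrArg (S.funMap _) (Subsingleton.elim _ _)
    | _, OagFunctions.const c, x => exact congrArg (S.funMap _) (Subsingleton.elim _ _)
    | _, OagFunctions.neg, x => exact congrArg (S.funMap _) (e1 x)
    | _, OagFunctions.add, x => exact congrArg (S.funMap _) (e2 x)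
  · funext n f x
    match n, f, x with
    | _, OagRelations.lt, x => exact congrArg (S.RelMap _) (e2 x)
    | _, OagRelations.pred j, x => exact congrArg (S.RelMap _) (e1 x)

theorem exists_ictWitness_of_isIctWitness {T : (oagLanguage C I).Theory} (hT : T.IsComplete)
    (G : ExpandedOAG.{u, v, w} C I) (hG : (G : Type w) ⊨ T) {κ : Type} {m : ℕ} {k : κ → ℕ}
    {φ : (i : κ) → (oagLanguage C I).Formula (Fin m ⊕ Fin (k i))} (h : T.IsIctWitness m k φ) :
    ∃ G' : ExpandedOAG.{u, v, max u v} C I, (G' : Type (max u v)) ⊨ T ∧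
      ∃ (a : (i : κ) → ℕ → Fin (k i) → G') (c : (κ → ℕ) → Fin m → G'),
        ∀ (η : κ → ℕ) (i : κ) (α : ℕ),
          (φ i).Realize (Sum.elim (c η) (a i α)) ↔ η i = α := by
  obtain ⟨M, a, c, hac⟩ := h
  obtain ⟨G', hG'⟩ := exists_toStructure_eq hT G hG (M := M)
  exact ⟨G', hG' (fun K _ => K ⊨ T ∧ ∃ (a : (i : κ) → ℕ → Fin (k i) → K) (c : (κ → ℕ) → Fin m → K),
        ∀ (η : κ → ℕ) (i : κ) (α : ℕ),
          (φ i).Realize (Sum.elim (c η) (a i α)) ↔ η i = α) ⟨M.is_model, a, c, hac⟩⟩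

end Models

/-! ### Sets determined by finitely many atoms -/

section Atoms

variable {C : Type u} {I : Type v} {V : Type*}

/-- The set defined by an atom: `0 < t` or `P_i t`. -/
def atomSet (G : ExpandedOAG.{u, v, w} C I) (A : (oagLanguage C I).Term V × Option I) :
    Set (V → G) :=
  {x | match A.2 with
    | none => 0 < A.1.realize x
    | some i => A.1.realize x ∈ G.pred i}

/-- Membership in `S` is determined by the truth values of finitely many atoms. -/
def AtomDetermined (G : ExpandedOAG.{u, v, w} C I) (S : Set (V → G)) : Prop :=
  ∃ As : List ((oagLanguage C I).Term V × Option I),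
    ∀ x y, (∀ A ∈ As, x ∈ G.atomSet A ↔ y ∈ G.atomSet A) → (x ∈ S ↔ y ∈ S)

variable (G : ExpandedOAG.{u, v, w} C I)

theorem AtomDetermined.imp {S S' : Set (V → G)} (h : G.AtomDetermined S)
    (h' : G.AtomDetermined S') : G.AtomDetermined {x | x ∈ S → x ∈ S'} := by
  obtain ⟨As, h⟩ := h
  obtain ⟨As', h'⟩ := h'
  refine ⟨As ++ As', fun x y hxy => ?_⟩
  exact imp_congr (h x y fun A hA => hxy A (List.mem_append_left _ hA))
    (h' x y fun A hA => hxy A (List.mem_append_right _ hA))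

theorem AtomDetermined.not {S : Set (V → G)} (h : G.AtomDetermined S) : G.AtomDetermined Sᶜ := by
  obtain ⟨As, h⟩ := h
  exact ⟨As, fun x y hxy => not_congr (h x y hxy)⟩

theorem atomDetermined_of_isAtomic {n : ℕ} {φ : (oagLanguage C I).BoundedFormula V n}
    (h : φ.IsAtomic) :
    G.AtomDetermined {x : V ⊕ Fin n → G | φ.Realize (x ∘ Sum.inl) (x ∘ Sum.inr)} := by
  cases h with
  | equal s t =>
    -- The order is linear, so an equality is the failure of two strict inequalities and needs no
    -- atom of its own.
    refine ⟨[(addTerm t (negTerm s), none), (addTerm s (negTerm t), none)], fun x y h => ?_⟩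
    simp only [List.mem_cons, List.not_mem_nil, or_false, forall_eq_or_imp, forall_eq, atomSet,
      realize_addTerm, realize_negTerm, Set.mem_ofPred_eq, ← sub_eq_add_neg, sub_pos] at h
    simp only [Set.mem_ofPred_eq, BoundedFormula.realize_bdEqual, Sum.elim_comp_inl_inr]
    have key : ∀ a b : G, a = b ↔ ¬ a < b ∧ ¬ b < a := fun a b => by
      rw [not_lt, not_lt, le_antisymm_iff, and_comm]
    rw [key, key, h.1, h.2]
  | @rel l R ts =>
    match l, R, ts with
    | _, OagRelations.lt, ts =>
      refine ⟨[(addTerm (ts 1) (negTerm (ts 0)), none)], fun x y h => ?_⟩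
      simp only [List.mem_cons, List.not_mem_nil, or_false, forall_eq, atomSet,
        realize_addTerm, realize_negTerm, Set.mem_ofPred_eq, ← sub_eq_add_neg, sub_pos] at h
      have e : ∀ x : V ⊕ Fin n → G, (Relations.boundedFormula (ltSymbol C I) ts).Realize
          (x ∘ Sum.inl) (x ∘ Sum.inr) ↔ (ts 0).realize x < (ts 1).realize x := fun x => by
        rw [BoundedFormula.realize_rel, Sum.elim_comp_inl_inr]
        rfl
      exact (e x).trans (h.trans (e y).symm)
    | _, OagRelations.pred i, ts =>
      refine ⟨[(ts 0, some i)], fun x y h => ?_⟩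
      simp only [List.mem_cons, List.not_mem_nil, or_false, forall_eq, atomSet,
        Set.mem_ofPred_eq] at h
      have e : ∀ x : V ⊕ Fin n → G, (Relations.boundedFormula (predSymbol C i) ts).Realize
          (x ∘ Sum.inl) (x ∘ Sum.inr) ↔ (ts 0).realize x ∈ G.pred i := fun x => by
        rw [BoundedFormula.realize_rel, Sum.elim_comp_inl_inr]
        rfl
      exact (e x).trans (h.trans (e y).symm)

theorem atomDetermined_of_isQF {n : ℕ} {φ : (oagLanguage C I).BoundedFormula V n}
    (h : φ.IsQF) :
    G.AtomDetermined {x : V ⊕ Fin n → G | φ.Realize (x ∘ Sum.inl) (x ∘ Sum.inr)} := by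
  induction h with
  | falsum => exact ⟨[], fun x y _ => Iff.rfl⟩
  | of_isAtomic h => exact G.atomDetermined_of_isAtomic h
  | imp _ _ ih ih' => exact ih.imp G ih'

end Atoms

end ExpandedOAG

/-! ### Independent sequences of subgroups -/

section IndepSubgroups

variable {A : Type*} [AddCommGroup A]

/-- Each of the subgroups `H n` has infinite index over every finite intersection of the others. -/
def IndepSubgroups (H : ℕ → AddSubgroup A) : Prop :=
  ∀ (N : Finset ℕ) (n : ℕ), n ∉ N → (H n).relIndex (⨅ k ∈ N, H k) = 0

theorem AddSubgroup.exists_ne_sub_mem_of_relIndex_lt {H K : AddSubgroup A} (h : H.relIndex K ≠ 0)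
    {k : ℕ} (hk : H.relIndex K < k) (x : Fin k → A) (hx : ∀ a, x a ∈ K) :
    ∃ a b, a ≠ b ∧ x a - x b ∈ H := by
  have hfin : Finite (K ⧸ H.addSubgroupOf K) := AddSubgroup.index_ne_zero_iff_finite.1 h
  let f : Fin k → K ⧸ H.addSubgroupOf K := fun a => QuotientAddGroup.mk ⟨x a, hx a⟩
  have hf : ¬ Function.Injective f := fun hf => by
    have := Nat.card_le_card_of_injective f hf
    rw [Nat.card_fin] at this
    exact absurd this (not_le.2 hk)
  rw [Function.not_injective_iff] at hf
  obtain ⟨b, a, hab, hne⟩ := hf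
  refine ⟨a, b, hne.symm, ?_⟩
  have := QuotientAddGroup.eq.1 hab
  rw [AddSubgroup.mem_addSubgroupOf] at this
  simpa [sub_eq_neg_add] using this

theorem AddSubgroup.exists_strictMono_sub_mem {H K : AddSubgroup A} (h : H.relIndex K ≠ 0)
    (x : ℕ → A) (hx : ∀ a, x a ∈ K) :
    ∃ f : ℕ → ℕ, StrictMono f ∧ ∀ a b, x (f a) - x (f b) ∈ H := by
  have hfin : Finite (K ⧸ H.addSubgroupOf K) := AddSubgroup.index_ne_zero_iff_finite.1 h
  let f : ℕ → K ⧸ H.addSubgroupOf K := fun a => QuotientAddGroup.mk ⟨x a, hx a⟩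
  obtain ⟨y, hy⟩ := Finite.exists_infinite_fiber f
  have hinf : (f ⁻¹' {y}).Infinite := Set.infinite_coe_iff.1 hy
  refine ⟨Nat.nth (· ∈ f ⁻¹' {y}), Nat.nth_strictMono hinf, fun a b => ?_⟩
  have ha : f _ = y := Nat.nth_mem_of_infinite hinf a
  have hb : f _ = y := Nat.nth_mem_of_infinite hinf b
  have := QuotientAddGroup.eq.1 (hb.trans ha.symm)
  rw [AddSubgroup.mem_addSubgroupOf] at this
  simpa [sub_eq_neg_add] using this

theorem AddSubgroup.exists_pairwise_sub_notMem {H K : AddSubgroup A} (h : H.relIndex K = 0) :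
    ∃ x : ℕ → A, (∀ a, x a ∈ K) ∧ ∀ a b, a ≠ b → x a - x b ∉ H := by
  have hinf : Infinite (K ⧸ H.addSubgroupOf K) := AddSubgroup.index_eq_zero_iff_infinite.1 h
  let e := Infinite.natEmbedding (K ⧸ H.addSubgroupOf K)
  choose y hy using fun a => QuotientAddGroup.mk_surjective (e a)
  refine ⟨fun a => y a, fun a => (y a).2, fun a b hab hmem => hab (e.injective ?_).symm⟩
  rw [← hy, ← hy, QuotientAddGroup.eq, AddSubgroup.mem_addSubgroupOf]
  simpa [sub_eq_neg_add] using hmem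

end IndepSubgroups

/-! ### Polarized Ramsey theorem and choice of colours -/

section Ramsey

/-- The finite polarized Ramsey theorem: a finite colouring of a product has large monochromatic
boxes. -/
theorem exists_monochromatic_box (R k : ℕ) {κ : Type} [Finite κ] (χ : (Fin R → ℕ) → κ) :
    ∃ f : Fin R → Fin k → ℕ, (∀ i, StrictMono (f i)) ∧
      ∃ c, ∀ q : Fin R → Fin k, χ (fun i => f i (q i)) = c := by
  classical
  induction R generalizing κ with
  | zero => exact ⟨fun i => i.elim0, fun i => i.elim0, χ (fun i => i.elim0), fun q =>
      congrArg χ (Subsingleton.elim _ _)⟩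
  | succ R ih =>
    have : Fintype κ := Fintype.ofFinite κ
    have : Nonempty κ := ⟨χ fun _ => 0⟩
    -- Colouring the other coordinates by the whole function of colours on `K` values of the first
    -- one makes that function a constant `g` on a box; by pigeonhole `g` takes some colour `k`
    -- times.
    let K := Fintype.card κ * k
    obtain ⟨f, hf, g, hg⟩ := ih (κ := Fin K → κ) fun p a => χ (Fin.cons (a : ℕ) p)
    obtain ⟨c, hc⟩ := Fintype.exists_le_card_fiber_of_mul_le_card g (n := k) (by simp [K])
    let e := Finset.orderEmbOfCardLe _ hc
    refine ⟨Fin.cons (fun a => (e a : ℕ)) f, ?_, c, fun q => ?_⟩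
    · intro i
      refine Fin.cases ?_ (fun i => ?_) i
      · exact fun a b hab => e.strictMono hab
      · simpa using hf i
    · have h1 := congrFun (hg fun i => q i.succ) (e (q 0))
      have h2 : g (e (q 0)) = c := by
        have := Finset.orderEmbOfCardLe_mem _ hc (q 0)
        simpa using this
      rw [← h2, ← h1]
      refine congrArg χ ?_
      funext i
      refine Fin.cases ?_ (fun i => ?_) i <;> simp

/-- If every path `p` has a witness whose colour in each row `i` is one of finitely many, then
we can fix a colour for each row so that this choice of colours occurs on arbitrarily large
boxes. -/
theorem exists_colors_on_boxes {X K : Type*} (sees : X → ℕ → K → Prop) (Cs : ℕ → List K)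
    (h : ∀ p : ℕ → ℕ, ∃ x, ∀ i, ∃ A ∈ Cs i, sees x (p i) A) :
    ∃ col : ℕ → K, (∀ i, col i ∈ Cs i) ∧ ∀ R : ℕ, ∃ F : ℕ → ℕ → ℕ,
      (∀ i < R, ∀ a b, a < b → b < R → F i a < F i b) ∧
      ∀ q : ℕ → ℕ, (∀ i < R, q i < R) → ∃ x, ∀ i < R, sees x (F i (q i)) (col i) := by
  classical
  choose x hx using h
  have hx' : ∀ p i, ∃ l : Fin (Cs i).length, sees (x p) (p i) ((Cs i).get l) := fun p i => by
    obtain ⟨A, hA, hs⟩ := hx p i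
    obtain ⟨l, hl⟩ := List.get_of_mem hA
    exact ⟨l, hl ▸ hs⟩
  choose c hc using hx'
  let ext : (R : ℕ) → (Fin R → ℕ) → ℕ → ℕ := fun R p i => if hi : i < R then p ⟨i, hi⟩ else 0
  have hbox : ∀ R : ℕ, ∃ (F : Fin R → Fin R → ℕ) (l : (i : ℕ) → Fin (Cs i).length),
      (∀ i, StrictMono (F i)) ∧ ∀ q : Fin R → Fin R, ∀ i < R,
        c (ext R fun i => F i (q i)) i = l i := fun R => by
    obtain ⟨F, hF, l, hl⟩ := exists_monochromatic_box R R
      (κ := (i : Fin R) → Fin (Cs i).length) fun p i => c (ext R p) i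
    -- The colour of rows `i ≥ R` is arbitrary; `c 0 i` only shows that one exists.
    refine ⟨F, fun i => if hi : i < R then l ⟨i, hi⟩ else c 0 i, hF, fun q i hi => ?_⟩
    beta_reduce
    rw [dif_pos hi, ← hl q]
  choose F l hF hl using hbox
  -- A row has finitely many colours, so its colour on the boxes of size `R` converges along the
  -- ultrafilter. Any finite set of rows shows its limit colours on arbitrarily large boxes.
  have hlim : ∀ i, ∃ a, ∀ᶠ R in (Filter.hyperfilter ℕ : Filter ℕ), l R i = a := fun i => by
    obtain ⟨a, ha⟩ := Ultrafilter.eq_pure_of_finite ((Filter.hyperfilter ℕ).map fun R => l R i)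
    refine ⟨a, ?_⟩
    have : ({a} : Set _) ∈ (Filter.hyperfilter ℕ).map fun R => l R i := by
      rw [ha]; exact Set.mem_singleton a
    exact this
  choose L hL using hlim
  refine ⟨fun i => (Cs i).get (L i), fun i => List.get_mem _ _, fun R => ?_⟩
  have h1 : ∀ᶠ S in (Filter.hyperfilter ℕ : Filter ℕ), ∀ i ∈ Finset.range R, l S i = L i :=
    (Filter.eventually_all_finset _).2 fun i _ => hL i
  have h2 : ∀ᶠ S in (Filter.hyperfilter ℕ : Filter ℕ), R ≤ S :=
    Nat.hyperfilter_le_atTop (Filter.eventually_ge_atTop R)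
  obtain ⟨S, hS, hRS⟩ := (h1.and h2).exists
  refine ⟨fun i a => if h : i < S ∧ a < S then F S ⟨i, h.1⟩ ⟨a, h.2⟩ else 0, ?_, ?_⟩
  · intro i hi a b hab hb
    beta_reduce
    rw [dif_pos ⟨by omega, by omega⟩, dif_pos ⟨by omega, by omega⟩]
    exact hF S _ hab
  · intro q hq
    let q' : Fin S → Fin S := fun i => if h : (i : ℕ) < R then ⟨q i, (hq i h).trans_le hRS⟩ else i
    refine ⟨x (ext S fun i => F S i (q' i)), fun i hi => ?_⟩
    have h3 := hc (ext S fun i => F S i (q' i)) i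
    rw [hl S q' i (by omega), hS i (Finset.mem_range.2 hi)] at h3
    have h4 : ext S (fun i => F S i (q' i)) i =
        if h : i < S ∧ q i < S then F S ⟨i, h.1⟩ ⟨q i, h.2⟩ else 0 := by
      have := hq i hi
      rw [dif_pos ⟨by omega, by omega⟩]
      simp only [ext]
      rw [dif_pos (by omega)]
      simp [q', hi]
    rwa [h4] at h3

end Ramsey

/-! ### Linear forms and sequences of atoms -/

section Rows

variable {G : Type*} [AddCommGroup G] {I : Type*} {m : ℕ}

/-- The homomorphism `x ↦ ∑ i, t i • x i`. -/
def linForm (G : Type*) [AddCommGroup G] {m : ℕ} (t : Fin m → ℤ) : (Fin m → G) →+ G where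
  toFun x := ∑ i, t i • x i
  map_zero' := by simp
  map_add' := by simp [Finset.sum_add_distrib]

theorem linForm_apply (t : Fin m → ℤ) (x : Fin m → G) : linForm G t x = ∑ i, t i • x i := rfl

theorem linForm_neg (t : Fin m → ℤ) (x : Fin m → G) : linForm G (-t) x = - linForm G t x := by
  simp [linForm_apply]

variable [LinearOrder G] (P : I → AddSubgroup G)

/-- Truth at `α` of the atom `0 < t x + u α` or `t x + u α ∈ P i`. -/
def SeqAtomHolds (A : (Fin m → ℤ) × (ℕ → G) × Option I) (x : Fin m → G) (α : ℕ) : Prop :=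
  match A.2.2 with
  | none => 0 < linForm G A.1 x + A.2.1 α
  | some i => linForm G A.1 x + A.2.1 α ∈ P i

/-- Either constant, or as far from constant as possible. -/
def TameSeq (u : ℕ → G) : Option I → Prop
  | none => (∀ a b, u a = u b) ∨ StrictMono u ∨ StrictAnti u
  | some i => (∀ a b, u a - u b ∈ P i) ∨ ∀ a b, a ≠ b → u a - u b ∉ P i

/-- Never constant. -/
def SpreadSeq (u : ℕ → G) : Option I → Prop
  | none => StrictMono u
  | some i => ∀ a b, a ≠ b → u a - u b ∉ P i

/-- The atom singles out the position `p`: `t x` lies in the cut between `-u (p + 1)` and `-u p`,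
or in the coset of `-u p`. -/
def SeqAtomSees (x : Fin m → G) (p : ℕ) (A : (Fin m → ℤ) × (ℕ → G) × Option I) : Prop :=
  match A.2.2 with
  | none => linForm G A.1 x + A.2.1 p ≤ 0 ∧ 0 ≤ linForm G A.1 x + A.2.1 (p + 1)
  | some i => linForm G A.1 x + A.2.1 p ∈ P i

theorem TameSeq.comp {u : ℕ → G} {o : Option I} (h : TameSeq P u o) {f : ℕ → ℕ}
    (hf : StrictMono f) : TameSeq P (u ∘ f) o := by
  cases o with
  | none =>
    exact h.imp (fun h a b => h _ _)
      (Or.imp (fun h => h.comp hf) fun h => h.comp_strictMono hf)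
  | some i => exact h.imp (fun h a b => h _ _) fun h a b hab => h _ _ (hf.injective.ne hab)

/-- Ramsey's theorem for pairs, applied twice for the order and once for congruence. -/
theorem exists_strictMono_tameSeq (u : ℕ → G) (o : Option I) :
    ∃ f : ℕ → ℕ, StrictMono f ∧ TameSeq P (u ∘ f) o := by
  cases o with
  | none =>
    obtain ⟨f, hf | hf⟩ := exists_increasing_or_nonincreasing_subseq (· < ·) u
    · exact ⟨f, f.strictMono, Or.inr (Or.inl fun a b hab => hf a b hab)⟩
    · obtain ⟨g, hg | hg⟩ := exists_increasing_or_nonincreasing_subseq (· > ·) (u ∘ f)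
      · exact ⟨f ∘ g, f.strictMono.comp g.strictMono, Or.inr (Or.inr fun a b hab => hg a b hab)⟩
      · have key : ∀ a b, a < b → u (f (g a)) = u (f (g b)) := fun a b hab =>
          le_antisymm (not_lt.1 (hg a b hab)) (not_lt.1 (hf _ _ (g.strictMono hab)))
        refine ⟨f ∘ g, f.strictMono.comp g.strictMono, Or.inl fun a b => ?_⟩
        rcases lt_trichotomy a b with h | h | h
        · exact key a b h
        · rw [h]
        · exact (key b a h).symm
  | some i =>
    have : IsTrans G fun a b => a - b ∈ P i := ⟨fun a b c h h' => by
      simpa using add_mem h h'⟩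
    obtain ⟨f, hf | hf⟩ := exists_increasing_or_nonincreasing_subseq (fun a b => a - b ∈ P i) u
    · refine ⟨f, f.strictMono, Or.inl fun a b => ?_⟩
      rcases lt_trichotomy a b with h | h | h
      · exact hf a b h
      · simp [h]
      · simpa using neg_mem (hf b a h)
    · refine ⟨f, f.strictMono, Or.inr fun a b hab hmem => ?_⟩
      rcases lt_or_gt_of_ne hab with h | h
      · exact hf a b h hmem
      · exact hf b a h (by simpa using neg_mem hmem)

theorem exists_strictMono_forall_tameSeq (As : List ((Fin m → ℤ) × (ℕ → G) × Option I)) :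
    ∃ f : ℕ → ℕ, StrictMono f ∧ ∀ A ∈ As, TameSeq P (A.2.1 ∘ f) A.2.2 := by
  induction As with
  | nil => exact ⟨id, strictMono_id, by simp⟩
  | cons A As ih =>
    obtain ⟨f, hf, h⟩ := ih
    obtain ⟨g, hg, h'⟩ := exists_strictMono_tameSeq P (A.2.1 ∘ f) A.2.2
    refine ⟨f ∘ g, hf.comp hg, fun B hB => ?_⟩
    rcases List.mem_cons.1 hB with rfl | hB
    · exact h'
    · exact (h B hB).comp P hg

end Rows

/-! ### From ict-patterns to independent subgroups -/

section RowPatterns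

variable {G : Type*} [AddCommGroup G] [LinearOrder G] [IsOrderedAddMonoid G] {I : Type*} {m : ℕ}
  (P : I → AddSubgroup G)

/-- A change of truth value forces `t x + u` to change sign between the positions `d * p` and `d *
(p + 1)`. Decreasing sequences are negated, which exchanges strict and weak inequalities; this is
why both bounds in `SeqAtomSees` are weak. -/
theorem TameSeq.exists_spreadSeq_sees {t : Fin m → ℤ} {u : ℕ → G} {f : ℕ → ℕ} {d p β : ℕ}
    (hu : TameSeq P (u ∘ f) (none : Option I)) (hd : 0 < d) {x : Fin m → G}
    (hβ : d * p < β) (hβ' : β ≤ d * (p + 1))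
    (hx : ¬ (SeqAtomHolds P (t, u, none) x (f (d * p)) ↔ SeqAtomHolds P (t, u, none) x (f β))) :
    (SpreadSeq P (fun q => u (f (d * q))) (none : Option I) ∧
      SeqAtomSees P x p (t, fun q => u (f (d * q)), none)) ∨
    (SpreadSeq P (fun q => - u (f (d * q))) (none : Option I) ∧
      SeqAtomSees P x p (-t, fun q => - u (f (d * q)), none)) := by
  have hmul : StrictMono fun q => d * q := fun a b hab => Nat.mul_lt_mul_of_pos_left hab hd
  simp only [SeqAtomHolds] at hx
  simp only [SeqAtomSees, linForm_neg]
  rcases hu with hu | hu | hu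
  · exact absurd (by rw [show u (f (d * p)) = u (f β) from hu _ _]) hx
  · have h1 : u (f (d * p)) < u (f β) := hu hβ
    have h2 : u (f β) ≤ u (f (d * (p + 1))) := hu.monotone hβ'
    refine Or.inl ⟨hu.comp hmul, ?_, ?_⟩
    · by_contra h
      push Not at h
      exact hx (iff_of_true h (h.trans (add_lt_add_right h1 _)))
    · by_contra h
      push Not at h
      refine hx (iff_of_false (not_lt.2 ?_) (not_lt.2 ?_))
      · exact ((add_le_add_right (h1.le.trans h2) _).trans_lt h).le
      · exact ((add_le_add_right h2 _).trans_lt h).le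
  · have h1 : u (f β) < u (f (d * p)) := hu hβ
    have h2 : u (f (d * (p + 1))) ≤ u (f β) := hu.antitone hβ'
    refine Or.inr ⟨fun a b hab => neg_lt_neg (hu (hmul hab)), ?_, ?_⟩
    · by_contra h
      rw [← neg_add, neg_nonpos, not_le] at h
      exact hx (iff_of_false h.not_gt (((add_lt_add_right h1 _).trans h).not_gt))
    · by_contra h
      rw [← neg_add, neg_nonneg, not_le] at h
      exact hx (iff_of_true (h.trans_le (add_le_add_right (h2.trans h1.le) _))
        (h.trans_le (add_le_add_right h2 _)))

/-- If a relation is determined by finitely many atoms then, after thinning, each position it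
isolates is seen by a never constant atom. -/
theorem exists_spread_atoms (As : List ((Fin m → ℤ) × (ℕ → G) × Option I))
    (Φ : (Fin m → G) → ℕ → Prop)
    (hΦ : ∀ x α β, (∀ A ∈ As, SeqAtomHolds P A x α ↔ SeqAtomHolds P A x β) → (Φ x α ↔ Φ x β)) :
    ∃ (g : ℕ → ℕ) (Cs : List ((Fin m → ℤ) × (ℕ → G) × Option I)),
      (∀ A ∈ Cs, SpreadSeq P A.2.1 A.2.2) ∧
      ∀ x p, (∀ α, Φ x α ↔ g p = α) → ∃ A ∈ Cs, SeqAtomSees P x p A := by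
  classical
  obtain ⟨f, hf, htame⟩ := exists_strictMono_forall_tameSeq P As
  -- There are more positions in `(d * p, d * (p + 1)]` than atoms, for the pigeonhole below.
  let d := As.length + 1
  have hd : 0 < d := Nat.succ_pos _
  have hmul : StrictMono fun q => d * q := fun a b hab => Nat.mul_lt_mul_of_pos_left hab hd
  let Cs := (As.flatMap fun A => [(A.1, fun q => A.2.1 (f (d * q)), A.2.2),
    (-A.1, fun q => - A.2.1 (f (d * q)), A.2.2)]).filter fun A => decide (SpreadSeq P A.2.1 A.2.2)
  have hCs1 : ∀ A ∈ As, SpreadSeq P (fun q => A.2.1 (f (d * q))) A.2.2 →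
      (A.1, fun q => A.2.1 (f (d * q)), A.2.2) ∈ Cs := fun A hA h =>
    List.mem_filter.2 ⟨List.mem_flatMap.2 ⟨A, hA, by simp⟩, by simpa using h⟩
  have hCs2 : ∀ A ∈ As, SpreadSeq P (fun q => - A.2.1 (f (d * q))) A.2.2 →
      (-A.1, fun q => - A.2.1 (f (d * q)), A.2.2) ∈ Cs := fun A hA h =>
    List.mem_filter.2 ⟨List.mem_flatMap.2 ⟨A, hA, by simp⟩, by simpa using h⟩
  refine ⟨fun p => f (d * p), Cs, fun A hA => by simpa using (List.mem_filter.1 hA).2,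
    fun x p hx => ?_⟩
  by_contra hno
  push Not at hno
  let Spiky (A : (Fin m → ℤ) × (ℕ → G) × Option I) (β : ℕ) : Prop :=
    ∃ i, A.2.2 = some i ∧ (∀ a b, a ≠ b → A.2.1 (f a) - A.2.1 (f b) ∉ P i) ∧
      SeqAtomHolds P A x (f β)
  have hspike : ∀ A ∈ As, ¬ Spiky A (d * p) := by
    rintro ⟨t, u, o⟩ hA ⟨i, rfl, hi, hx⟩
    exact hno _ (hCs1 _ hA fun a b hab => hi _ _ (hmul.injective.ne hab)) hx
  -- The value `t x` meets at most one coset of a nowhere constant sequence, so each atom spoils at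
  -- most one of the `d` candidates.
  obtain ⟨β, hβ, hβ', hβs⟩ : ∃ β, d * p < β ∧ β ≤ d * (p + 1) ∧ ∀ A ∈ As, ¬ Spiky A β := by
    by_contra hall
    push Not at hall
    have h1 : ∀ e : Fin d, ∃ l : Fin As.length, Spiky (As.get l) (d * p + 1 + e) := fun e => by
      obtain ⟨A, hA, hs⟩ := hall (d * p + 1 + e) (by omega) (by rw [mul_add]; omega)
      obtain ⟨l, hl⟩ := List.get_of_mem hA
      exact ⟨l, hl ▸ hs⟩
    choose l hl using h1
    obtain ⟨e, e', hne, hee⟩ := Fintype.exists_ne_map_eq_of_card_lt l (by simp [d])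
    obtain ⟨i, hi, hd1, h1⟩ := hl e
    obtain ⟨i', hi', -, h2⟩ := hl e'
    rw [← hee] at hi' h2
    have hii : i' = i := Option.some.inj (hi'.symm.trans hi)
    subst hii
    simp only [SeqAtomHolds, hi] at h1 h2
    refine hd1 (d * p + 1 + e) (d * p + 1 + e') (fun h => hne (Fin.ext (by omega))) ?_
    simpa using sub_mem h1 h2
  -- Hence some atom changes its truth value between these positions. Constant atoms cannot, coset
  -- atoms are false at both, and an order atom would see `p`.
  have hnot : ¬ (Φ x (f (d * p)) ↔ Φ x (f β)) := fun h => by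
    have h1 := (hx _).1 (h.1 ((hx _).2 rfl))
    exact absurd (hf.injective h1) hβ.ne
  refine hnot (hΦ _ _ _ fun A hA => ?_)
  by_contra hA'
  obtain ⟨t, u, o⟩ := A
  cases o with
  | none =>
    rcases TameSeq.exists_spreadSeq_sees P (htame _ hA) hd hβ hβ' hA' with h | h
    · exact hno _ (hCs1 _ hA h.1) h.2
    · exact hno _ (hCs2 _ hA h.1) h.2
  | some i =>
    rcases htame _ hA with h | h
    · refine hA' ?_
      have h1 : u (f (d * p)) - u (f β) ∈ P i := h _ _
      simp only [SeqAtomHolds]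
      constructor <;> intro h2
      · have h3 := sub_mem h2 h1
        rwa [add_sub_assoc, sub_sub_cancel] at h3
      · simpa using add_mem h2 h1
    · exact hA' (iff_of_false (fun hh => hspike _ hA ⟨i, rfl, h, hh⟩)
        fun hh => hβs _ hA ⟨i, rfl, h, hh⟩)

/-- The rows singled out by cuts are linearly independent, hence few. -/
theorem finite_order_rows (col : ℕ → (Fin m → ℤ) × (ℕ → G) × Option I)
    (hcol : ∀ i, SpreadSeq P (col i).2.1 (col i).2.2)
    (hbox : ∀ R : ℕ, ∃ F : ℕ → ℕ → ℕ, (∀ i < R, ∀ a b, a < b → b < R → F i a < F i b) ∧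
      ∀ q : ℕ → ℕ, (∀ i < R, q i < R) → ∃ x, ∀ i < R, SeqAtomSees P x (F i (q i)) (col i)) :
    {i | (col i).2.2 = none}.Finite := by
  classical
  by_contra hinf
  rw [← Set.Infinite] at hinf
  let e := Nat.nth fun i => i ∈ {i | (col i).2.2 = none}
  have he : StrictMono e := Nat.nth_strictMono hinf
  have hen : ∀ j, (col (e j)).2.2 = none := fun j => Nat.nth_mem_of_infinite hinf j
  -- A nontrivial relation between `m + 1` integral forms in `m` variables.
  obtain ⟨k, hk, j0, hj0⟩ : ∃ k : Fin (m + 1) → ℤ,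
      (∑ j, k j • (col (e j)).1 = 0) ∧ ∃ j, k j ≠ 0 := by
    have : ¬ LinearIndependent ℤ fun j : Fin (m + 1) => (col (e j)).1 := fun h => by
      have := h.fintype_card_le_finrank
      simp at this
    rw [Fintype.not_linearIndependent_iff] at this
    exact this
  -- Exceeds the indices of the `m + 1` rows and the positions `0` and `2`.
  let R := e m + 4
  obtain ⟨F, hF, hx⟩ := hbox R
  have hlt : ∀ j : Fin (m + 1), e j < R := fun j => by
    have := he.monotone (Nat.le_of_lt_succ j.2)
    omega
  have hu : ∀ j : Fin (m + 1), ∀ x p, SeqAtomSees P x p (col (e j)) →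
      linForm G (col (e j)).1 x ≤ - (col (e j)).2.1 p ∧
      - (col (e j)).2.1 (p + 1) ≤ linForm G (col (e j)).1 x := fun j x p h => by
    simp only [SeqAtomSees, hen j] at h
    exact ⟨le_neg_iff_add_nonpos_right.2 h.1, neg_le_iff_add_nonneg.2 h.2⟩
  have hmono : ∀ j : Fin (m + 1), StrictMono (col (e j)).2.1 := fun j => by
    have := hcol (e j)
    rw [hen j] at this
    exact this
  -- Skipping position `1` gives `F _ 0 + 1 < F _ 2`, so the two cuts share no end point and the
  -- comparison is strict.
  have hcomp : ∀ j : Fin (m + 1), ∀ x y, SeqAtomSees P x (F (e j) 2) (col (e j)) →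
      SeqAtomSees P y (F (e j) 0) (col (e j)) →
        linForm G (col (e j)).1 x < linForm G (col (e j)).1 y := fun j x y hx hy => by
    have h1 := hF (e j) (hlt j) 0 1 (by omega) (by omega)
    have h2 := hF (e j) (hlt j) 1 2 (by omega) (by omega)
    refine ((hu j x _ hx).1.trans_lt (neg_lt_neg (hmono j ?_))).trans_le (hu j y _ hy).2
    omega
  have hsum : ∀ x : Fin m → G, ∑ j, k j • linForm G (col (e j)).1 x = 0 := fun x => by
    have h1 : ∀ j, k j • linForm G (col (e j)).1 x = ∑ i, (k j • (col (e j)).1) i • x i :=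
      fun j => by simp [linForm_apply, Finset.smul_sum, mul_smul]
    rw [Finset.sum_congr rfl fun j _ => h1 j, Finset.sum_comm]
    refine Finset.sum_eq_zero fun i _ => ?_
    rw [← Finset.sum_smul, ← Finset.sum_apply, hk, Pi.zero_apply, zero_smul]
  -- Positions follow the signs of the relation: every nonzero term increases from `x` to `y`,
  -- although both sums vanish.
  let q : ℕ → ℕ := fun i => if ∃ j : Fin (m + 1), e j = i ∧ 0 < k j then 2 else 0
  have hq : ∀ j : Fin (m + 1), q (e j) = if 0 < k j then 2 else 0 := fun j => by
    refine if_congr ⟨?_, fun h => ⟨j, rfl, h⟩⟩ rfl rfl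
    rintro ⟨j', hj', h⟩
    rwa [Fin.ext (he.injective hj')] at h
  obtain ⟨x, hx1⟩ := hx q fun i _ => by simp only [q]; split_ifs <;> omega
  obtain ⟨y, hy1⟩ := hx (fun i => 2 - q i) fun i _ => by omega
  have hle : ∀ j, k j • linForm G (col (e j)).1 x ≤ k j • linForm G (col (e j)).1 y ∧
      (k j ≠ 0 → k j • linForm G (col (e j)).1 x < k j • linForm G (col (e j)).1 y) := fun j => by
    have h1 := hx1 (e j) (hlt j)
    have h2 := hy1 (e j) (hlt j)
    simp only [hq] at h1 h2
    rcases lt_trichotomy (k j) 0 with h | h | h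
    · rw [if_neg h.not_gt] at h1 h2
      have := zsmul_lt_zsmul_right (neg_pos.2 h) (hcomp j y x h2 h1)
      rw [neg_smul, neg_smul, neg_lt_neg_iff] at this
      exact ⟨this.le, fun _ => this⟩
    · rw [h]
      simp
    · rw [if_pos h] at h1 h2
      have := zsmul_lt_zsmul_right h (hcomp j x y h1 h2)
      exact ⟨this.le, fun _ => this⟩
  have := Finset.sum_lt_sum (s := Finset.univ) (fun j _ => (hle j).1)
    ⟨j0, Finset.mem_univ _, (hle j0).2 hj0⟩
  rw [hsum, hsum] at this
  exact lt_irrefl _ this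

/-- Rows singled out by cosets give an independent sequence of subgroups. -/
theorem exists_indepSubgroups_of_boxes (col : ℕ → (Fin m → ℤ) × (ℕ → G) × Option I)
    (hcol : ∀ i, SpreadSeq P (col i).2.1 (col i).2.2)
    (hbox : ∀ R : ℕ, ∃ F : ℕ → ℕ → ℕ, (∀ i < R, ∀ a b, a < b → b < R → F i a < F i b) ∧
      ∀ q : ℕ → ℕ, (∀ i < R, q i < R) → ∃ x, ∀ i < R, SeqAtomSees P x (F i (q i)) (col i)) :
    ∃ (t : ℕ → Fin m → ℤ) (j : ℕ → I),
      IndepSubgroups fun n => (P (j n)).comap (linForm G (t n)) := by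
  classical
  have hinf : {i | (col i).2.2 = none}ᶜ.Infinite :=
    (finite_order_rows P col hcol hbox).infinite_compl
  let e := Nat.nth fun i => i ∈ {i | (col i).2.2 = none}ᶜ
  have he : StrictMono e := Nat.nth_strictMono hinf
  have hen : ∀ n, ∃ j, (col (e n)).2.2 = some j := fun n =>
    Option.ne_none_iff_exists'.1 (Nat.nth_mem_of_infinite hinf n)
  choose j hj using hen
  have hsees : ∀ n x p, SeqAtomSees P x p (col (e n)) ↔
      linForm G (col (e n)).1 x + (col (e n)).2.1 p ∈ P (j n) := fun n x p => by
    simp only [SeqAtomSees, hj]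
  refine ⟨fun n => (col (e n)).1, j, fun N n hn => ?_⟩
  by_contra hne
  set H : ℕ → AddSubgroup (Fin m → G) := fun n => (P (j n)).comap (linForm G (col (e n)).1)
  let r := (H n).relIndex (⨅ k ∈ N, H k)
  -- Large enough for all rows involved and for more than `r` positions in row `e n`.
  let R := e (N.sup id + n) + r + 1
  have hlt : ∀ k ∈ insert n N, e k < R := fun k hk => by
    have : e k ≤ e (N.sup id + n) := he.monotone (by
      rcases Finset.mem_insert.1 hk with rfl | hk
      · omega
      · have : k ≤ N.sup id := Finset.le_sup (f := id) hk
        omega)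
    omega
  obtain ⟨F, hF, hx⟩ := hbox R
  -- Only the position in row `e n` varies, so differences of the `x a` lie in the subgroups of all
  -- rows of `N`.
  choose x hx using fun a : Fin R => hx (fun i => if i = e n then a else 0) fun i _ => by
    split_ifs <;> omega
  let a0 : Fin R := ⟨0, by omega⟩
  obtain ⟨a, b, hab, hmem⟩ := AddSubgroup.exists_ne_sub_mem_of_relIndex_lt hne
    (show r < R by omega) (fun a => x a - x a0) fun a => by
      simp only [AddSubgroup.mem_iInf]
      intro k hk
      have hkn : e k ≠ e n := he.injective.ne (ne_of_mem_of_not_mem hk hn)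
      have h1 := (hsees k _ _).1 (hx a (e k) (hlt k (Finset.mem_insert_of_mem hk)))
      have h2 := (hsees k _ _).1 (hx a0 (e k) (hlt k (Finset.mem_insert_of_mem hk)))
      rw [if_neg hkn] at h1 h2
      have h3 := sub_mem h1 h2
      rw [add_sub_add_right_eq_sub, ← map_sub] at h3
      exact h3
  have h1 := (hsees n _ _).1 (hx a (e n) (hlt n (Finset.mem_insert_self _ _)))
  have h2 := (hsees n _ _).1 (hx b (e n) (hlt n (Finset.mem_insert_self _ _)))
  rw [if_pos rfl] at h1 h2
  rw [sub_sub_sub_cancel_right] at hmem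
  have h4 : linForm G (col (e n)).1 (x a - x b) ∈ P (j n) := hmem
  have h3 := sub_mem (sub_mem h1 h2) h4
  rw [map_sub, add_sub_add_comm, add_sub_cancel_left] at h3
  have hs := hcol (e n)
  rw [hj n] at hs
  refine hs _ _ ?_ h3
  have hFn := hF (e n) (hlt n (Finset.mem_insert_self _ _))
  rcases lt_or_gt_of_ne hab with h | h
  · exact (hFn a b h b.2).ne
  · exact (hFn b a h a.2).ne'

/-- An ict-pattern for relations determined by finitely many atoms yields an independent sequence
of subgroups defined by linear forms. -/
theorem exists_indepSubgroups_of_pattern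
    (As : ℕ → List ((Fin m → ℤ) × (ℕ → G) × Option I)) (Φ : ℕ → (Fin m → G) → ℕ → Prop)
    (hΦ : ∀ i x α β, (∀ A ∈ As i, SeqAtomHolds P A x α ↔ SeqAtomHolds P A x β) →
      (Φ i x α ↔ Φ i x β))
    (c : (ℕ → ℕ) → Fin m → G) (hc : ∀ η i α, Φ i (c η) α ↔ η i = α) :
    ∃ (t : ℕ → Fin m → ℤ) (j : ℕ → I),
      IndepSubgroups fun n => (P (j n)).comap (linForm G (t n)) := by
  choose g Cs hCs hsees using fun i => exists_spread_atoms P (As i) (Φ i) (hΦ i)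
  obtain ⟨col, hcol, hbox⟩ := exists_colors_on_boxes (SeqAtomSees P) Cs fun p =>
    ⟨c fun i => g i (p i), fun i => hsees i _ _ fun α => hc _ i α⟩
  exact exists_indepSubgroups_of_boxes P col (fun i => hCs i _ (hcol i)) hbox

end RowPatterns

/-! ### Eliminating one variable -/

section Projection

variable {A B : Type*} [AddCommGroup A] [AddCommGroup B]

/-- If, arbitrarily far out, an independent sequence of subgroups is dependent on the kernel of
`π`, then the images of suitable finite intersections form an independent sequence. -/
theorem IndepSubgroups.exists_map {H : ℕ → AddSubgroup A} (hH : IndepSubgroups H) (π : A →+ B)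
    (h : ∀ b : ℕ, ∃ (N : Finset ℕ) (n : ℕ), n ∉ N ∧ (∀ k ∈ insert n N, b ≤ k) ∧
      (H n).relIndex ((⨅ k ∈ N, H k) ⊓ π.ker) ≠ 0) :
    ∃ N : ℕ → Finset ℕ, IndepSubgroups fun r => (⨅ k ∈ N r, H k).map π := by
  classical
  choose N n hn hb hfin using h
  -- Each block starts beyond the previous one, so the blocks `E r` are disjoint.
  let b : ℕ → ℕ := fun r => Nat.rec 0 (fun _ b => (insert (n b) (N b)).sup id + 1) r
  let E : ℕ → Finset ℕ := fun r => insert (n (b r)) (N (b r))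
  have hb1 : ∀ r, ∀ k ∈ E r, b r ≤ k := fun r k hk => hb _ k hk
  have hb2 : ∀ r, ∀ k ∈ E r, k < b (r + 1) := fun r k hk =>
    Nat.lt_succ_of_le (Finset.le_sup (f := id) hk)
  have hbmono : Monotone b := monotone_nat_of_le_succ fun r =>
    ((hb1 r _ (Finset.mem_insert_self _ _)).trans_lt (hb2 r _ (Finset.mem_insert_self _ _))).le
  have hdisj : ∀ r s k, k ∈ E r → k ∈ E s → r = s := fun r s k hr hs => by
    by_contra hne
    rcases lt_or_gt_of_ne hne with h | h
    · have h1 := hb2 r k hr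
      have h2 := hb1 s k hs
      have h3 := hbmono (Nat.succ_le_of_lt h)
      simp only [Nat.succ_eq_add_one] at h3
      omega
    · have h1 := hb2 s k hs
      have h2 := hb1 r k hr
      have h3 := hbmono (Nat.succ_le_of_lt h)
      simp only [Nat.succ_eq_add_one] at h3
      omega
  refine ⟨E, fun Q r hr => ?_⟩
  by_contra hne
  set n0 := n (b r) with hn0
  set N0 := N (b r) with hN0
  have hn0E : n0 ∈ E r := Finset.mem_insert_self _ _
  let M := Q.biUnion E ∪ N0
  have hM : n0 ∉ M := fun hmem => by
    rcases Finset.mem_union.1 hmem with hmem | hmem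
    · obtain ⟨q, hq, hqE⟩ := Finset.mem_biUnion.1 hmem
      exact hr (hdisj _ _ _ hn0E hqE ▸ hq)
    · exact hn _ hmem
  obtain ⟨x, hx, hxp⟩ := AddSubgroup.exists_pairwise_sub_notMem (hH M n0 hM)
  simp only [AddSubgroup.mem_iInf] at hx
  obtain ⟨f, hf, hfx⟩ := AddSubgroup.exists_strictMono_sub_mem hne (fun l => π (x l)) fun l => by
    simp only [AddSubgroup.mem_iInf]
    intro q hq
    refine AddSubgroup.mem_map_of_mem _ ?_
    simp only [AddSubgroup.mem_iInf]
    exact fun k hk => hx l k (Finset.mem_union_left _ (Finset.mem_biUnion.2 ⟨q, hq, hk⟩))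
  -- Subtracting the lifts `e a` moves the differences into `π.ker` without changing their classes
  -- modulo `H n0`. Finite index there makes two of the `x` congruent, a contradiction.
  choose e he hee using fun a => AddSubgroup.mem_map.1 (hfx a 0)
  simp only [AddSubgroup.mem_iInf] at he
  obtain ⟨g, hg, hgy⟩ := AddSubgroup.exists_strictMono_sub_mem (hfin (b r))
    (fun a => x (f a) - x (f 0) - e a) fun a => by
      refine AddSubgroup.mem_inf.2 ⟨?_, ?_⟩
      · simp only [AddSubgroup.mem_iInf]
        intro k hk
        have hkM : k ∈ M := Finset.mem_union_right _ hk
        exact sub_mem (sub_mem (hx _ k hkM) (hx _ k hkM)) (he a k (Finset.mem_insert_of_mem hk))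
      · rw [AddMonoidHom.mem_ker, map_sub, map_sub, hee, sub_self]
  refine hxp (f (g 0)) (f (g 1)) (hf.injective.ne (hg.injective.ne (by norm_num))) ?_
  have h1 := add_mem (hgy 0 1) (sub_mem (he (g 0) n0 hn0E) (he (g 1) n0 hn0E))
  have h2 : x (f (g 0)) - x (f 0) - e (g 0) - (x (f (g 1)) - x (f 0) - e (g 1)) +
      (e (g 0) - e (g 1)) = x (f (g 0)) - x (f (g 1)) := by abel
  rwa [h2] at h1

variable {G : Type*} [AddCommGroup G] {I : Type*}

/-- The restriction of a tuple to all but its last coordinate. -/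
def initHom (G : Type*) [AddCommGroup G] (m : ℕ) : (Fin (m + 1) → G) →+ (Fin m → G) where
  toFun x := x ∘ Fin.castSucc
  map_zero' := rfl
  map_add' _ _ := rfl

/-- The kernel of the projection is a copy of `G` on which `t n` is multiplication by its last
coefficient. If a late coefficient vanishes, the kernel lies in that subgroup; otherwise `hno` for
the shifted sequence gives the dependence. -/
theorem IndepSubgroups.exists_map_initHom {P : I → AddSubgroup G} {m : ℕ}
    {t : ℕ → Fin (m + 1) → ℤ} {j : ℕ → I}
    (hH : IndepSubgroups fun n => (P (j n)).comap (linForm G (t n)))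
    (hno : ∀ (i : ℕ → I) (ι : ℕ → ℤ), (∀ n, ι n ≠ 0) →
      ¬ IndepSubgroups fun n => (P (i n)).comap (zsmulAddGroupHom (ι n) : G →+ G)) :
    ∃ N : ℕ → Finset ℕ, IndepSubgroups fun r =>
      (⨅ k ∈ N r, (P (j k)).comap (linForm G (t k))).map (initHom G m) := by
  classical
  refine hH.exists_map _ fun b => ?_
  let s : G →+ (Fin (m + 1) → G) := AddMonoidHom.single (fun _ => G) (Fin.last m)
  have hs : ∀ k y, linForm G (t k) (s y) = t k (Fin.last m) • y := fun k y => by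
    rw [linForm_apply, Finset.sum_eq_single (Fin.last m)]
    · simp [s]
    · intro l _ hl
      simp [s, Pi.single_eq_of_ne hl]
    · simp
  have hker : ∀ x ∈ (initHom G m).ker, s (x (Fin.last m)) = x := fun x hx => by
    funext l
    refine Fin.lastCases ?_ (fun l => ?_) l
    · simp [s]
    · have : x l.castSucc = 0 := congrFun (AddMonoidHom.mem_ker.1 hx) l
      simp [s, this]
  by_cases h0 : ∃ n, b ≤ n ∧ t n (Fin.last m) = 0
  · obtain ⟨n, hbn, hn⟩ := h0
    refine ⟨∅, n, by simp, by simpa using hbn, ?_⟩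
    refine ne_of_eq_of_ne (AddSubgroup.relIndex_eq_one.2 fun x hx => ?_) one_ne_zero
    rw [AddSubgroup.mem_comap, ← hker x hx.2, hs, hn, zero_smul]
    exact zero_mem _
  · push Not at h0
    have hdep := hno (fun n => j (b + n)) (fun n => t (b + n) (Fin.last m)) fun n => h0 _ (by omega)
    simp only [IndepSubgroups, not_forall] at hdep
    obtain ⟨N, n, hn, hfin⟩ := hdep
    refine ⟨N.map (addLeftEmbedding b), b + n, by simpa using hn, by simp, fun h => hfin ?_⟩
    have hcomap : ∀ k, ((P (j k)).comap (linForm G (t k))).comap s =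
        (P (j k)).comap (zsmulAddGroupHom (t k (Fin.last m))) := fun k => by
      ext y
      rw [AddSubgroup.mem_comap, AddSubgroup.mem_comap, AddSubgroup.mem_comap, hs]
      rfl
    rw [← hcomap, AddSubgroup.relIndex_comap]
    refine AddSubgroup.relIndex_eq_zero_of_le_right (fun x hx => ?_) h
    obtain ⟨hx1, hx2⟩ := AddSubgroup.mem_inf.1 hx
    refine AddSubgroup.mem_map.2 ⟨x (Fin.last m), ?_, hker x hx2⟩
    simp only [AddSubgroup.mem_iInf, Finset.mem_map, addLeftEmbedding_apply,
      forall_exists_index, and_imp, forall_apply_eq_imp_iff₂] at hx1 ⊢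
    intro k hk
    rw [← hcomap, AddSubgroup.mem_comap, hker x hx2]
    exact hx1 k hk

end Projection

/-! ### The characterisation of strong dependence -/

namespace ExpandedOAG
open FirstOrder.Language

variable {C : Type u} {I : Type v}

/-- The formula `θ (x - y)`. -/
def diffFormula {m : ℕ} (θ : (oagLanguage C I).Formula (Fin m)) :
    (oagLanguage C I).Formula (Fin m ⊕ Fin m) :=
  BoundedFormula.subst θ fun l => addTerm (Term.var (Sum.inl l)) (negTerm (Term.var (Sum.inr l)))

theorem realize_diffFormula (G : ExpandedOAG.{u, v, w} C I) {m : ℕ}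
    (θ : (oagLanguage C I).Formula (Fin m)) (x y : Fin m → G) :
    (diffFormula θ).Realize (Sum.elim x y) ↔ θ.Realize (x - y) := by
  rw [diffFormula, Formula.Realize, BoundedFormula.realize_subst, Formula.Realize]
  refine iff_of_eq (congrArg₂ _ (funext fun l => ?_) rfl)
  simp [sub_eq_add_neg]

/-- For finitely many rows, representatives of distinct classes modulo `D r` can be taken inside all
the other subgroups. The sum of one representative per row then has the prescribed class in every
row. -/
theorem isIctWitness_of_indepSubgroups {T : (oagLanguage C I).Theory}
    (G : ExpandedOAG.{u, v, w} C I) (hG : (G : Type w) ⊨ T) {m : ℕ}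
    {D : ℕ → AddSubgroup (Fin m → G)} (hD : IndepSubgroups D)
    (θ : ℕ → (oagLanguage C I).Formula (Fin m)) (hθ : ∀ r x, (θ r).Realize x ↔ x ∈ D r) :
    T.IsIctWitness m (fun _ => m) (fun r => diffFormula (θ r)) := by
  classical
  refine Theory.isIctWitness_of_finite G fun F => ?_
  let Q : Finset ℕ := F.image fun p => p.2.1
  choose x hx hxp using fun r => AddSubgroup.exists_pairwise_sub_notMem
    (hD (Q.erase r) r (Finset.notMem_erase _ _))
  simp only [AddSubgroup.mem_iInf] at hx
  refine ⟨x, fun η => ∑ r ∈ Q, x r (η r), ?_⟩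
  rintro ⟨η, r, α⟩ hp
  have hr : r ∈ Q := Finset.mem_image_of_mem (fun p : (ℕ → ℕ) × ℕ × ℕ => p.2.1) hp
  rw [realize_diffFormula, hθ]
  have h1 : ∑ q ∈ Q.erase r, x q (η q) ∈ D r := sum_mem fun q hq =>
    hx q _ r (Finset.mem_erase.2 ⟨(Finset.ne_of_mem_erase hq).symm, hr⟩)
  dsimp only
  rw [← Finset.add_sum_erase Q _ hr, add_sub_right_comm, AddSubgroup.add_mem_cancel_right _ h1]
  refine ⟨fun h => ?_, fun h => ?_⟩
  · by_contra hne
    exact hxp r _ _ hne h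
  · rw [show η r = α from h, sub_self]
    exact zero_mem _

/-- Projection is an existential quantifier. The formula obtained need not be quantifier-free;
quantifier elimination is applied anew at the next induction step. -/
theorem exists_formula_map_initHom (G : ExpandedOAG.{u, v, max u v} C I) {m : ℕ} (N : Finset ℕ)
    (t : ℕ → Fin (m + 1) → ℤ) (j : ℕ → I) :
    ∃ θ : (oagLanguage C I).Formula (Fin m), ∀ x : Fin m → G, θ.Realize x ↔
      x ∈ (⨅ k ∈ N, (G.pred (j k)).comap (linForm G (t k))).map (initHom G m) := by
  have h1 : ∀ k, (∅ : Set G).Definable (oagLanguage C I)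
      ((G.pred (j k)).comap (linForm G (t k)) : Set (Fin (m + 1) → G)) := fun k => by
    rw [Set.empty_definable_iff]
    obtain ⟨s, hs⟩ := exists_sumTerm.{u, v, max u v} (C := C) (I := I) (t k)
    refine ⟨predFormula (j k) s, ?_⟩
    ext x
    rw [Set.mem_ofPred_eq, realize_predFormula, hs]
    rfl
  have h2 := (Set.definable_biInter_finset h1 N).image_comp (Fin.castSucc : Fin m → Fin (m + 1))
  obtain ⟨θ, hθ⟩ := Set.empty_definable_iff.1 h2
  refine ⟨θ, fun x => ?_⟩
  have h3 : θ.Realize x ↔ x ∈ Set.ofPred θ.Realize := Iff.rfl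
  rw [h3, ← hθ]
  simp only [Set.mem_image, Set.mem_iInter, AddSubgroup.mem_map, AddSubgroup.mem_iInf]
  rfl

/-- An independent sequence of subgroups `{x | ι n • x ∈ P_{i n}}` yields a pattern. -/
theorem realizesSubgroupPattern_of_indepSubgroups {T : (oagLanguage C I).Theory}
    (hT : T.IsComplete) (G : ExpandedOAG.{u, v, max u v} C I) (hG : (G : Type (max u v)) ⊨ T)
    {i : ℕ → I} {ι : ℕ → ℤ}
    (h : IndepSubgroups fun n => (G.pred (i n)).comap (zsmulAddGroupHom (ι n) : G →+ G)) :
    RealizesSubgroupPattern T i ι := by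
  choose s hs using fun n => exists_zsmulTerm.{u, v, max u v} (ι n)
    (Term.var 0 : (oagLanguage C I).Term (Fin 1))
  have hreal : ∀ n (G : ExpandedOAG.{u, v, max u v} C I) (x : Fin 1 → G),
      (predFormula (i n) (s n)).Realize x ↔ ι n • x 0 ∈ G.pred (i n) := fun n G x => by
    rw [realize_predFormula, hs, Term.realize_var]
  let ev : (Fin 1 → G) →+ G := Pi.evalAddMonoidHom (fun _ => G) 0
  have hev : Function.Surjective ev := fun y => ⟨fun _ => y, rfl⟩
  have hD : IndepSubgroups fun n =>
      ((G.pred (i n)).comap (zsmulAddGroupHom (ι n) : G →+ G)).comap ev := fun N n hn => by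
    have hinf : (⨅ k ∈ N, ((G.pred (i k)).comap (zsmulAddGroupHom (ι k) : G →+ G)).comap ev) =
        (⨅ k ∈ N, (G.pred (i k)).comap (zsmulAddGroupHom (ι k) : G →+ G)).comap ev := by
      ext x
      simp only [AddSubgroup.mem_iInf, AddSubgroup.mem_comap]
    rw [AddSubgroup.relIndex_comap, hinf, AddSubgroup.map_comap_eq_self_of_surjective hev]
    exact h N n hn
  -- Independence in `G` realises only finite parts; compactness provides a model with the full
  -- pattern.
  obtain ⟨G', hG', a, c, hac⟩ := exists_ictWitness_of_isIctWitness hT G hG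
    (isIctWitness_of_indepSubgroups G hG hD (fun n => predFormula (i n) (s n)) fun n x =>
      hreal n G x)
  have hac' : ∀ η n α, ι n • (c η 0 - a n α 0) ∈ G'.pred (i n) ↔ η n = α := fun η n α => by
    rw [← hac, realize_diffFormula, hreal]
    rfl
  refine ⟨G', hG', fun n l => a n l 0, fun n l₁ l₂ hl hmem => ?_, fun η =>
    ⟨c η 0, fun n => (hac' η n _).2 rfl⟩⟩
  have h1 := (hac' (fun _ => l₂) n l₂).2 rfl
  have h2 := add_mem h1 hmem
  rw [← smul_add, sub_add_sub_cancel] at h2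
  exact hl.ne' ((hac' _ n l₁).1 h2)

theorem not_stronglyDependent_of_realizesSubgroupPattern {T : (oagLanguage C I).Theory}
    {i : ℕ → I} {ι : ℕ → ℤ} (h : RealizesSubgroupPattern T i ι) : ¬ T.StronglyDependent := by
  obtain ⟨G, hG, b, hb, hc⟩ := h
  choose c hc using hc
  choose s hs using fun n => exists_zsmulTerm.{u, v, max u v} (ι n)
    (Term.var 0 : (oagLanguage C I).Term (Fin 1))
  refine fun hT => hT 1 (fun _ => 1) (fun n => diffFormula (predFormula (i n) (s n)))
    (Theory.isIctWitness_of_finite G fun F => ⟨fun n l _ => b n l, fun η _ => c η, ?_⟩)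
  rintro ⟨η, n, α⟩ -
  rw [realize_diffFormula, realize_predFormula, hs, Term.realize_var]
  change ι n • (c η - b n α) ∈ G.pred (i n) ↔ η n = α
  refine ⟨fun h => ?_, fun h => h ▸ hc η n⟩
  have h1 := sub_mem h (hc η n)
  rw [← smul_sub, sub_sub_sub_cancel_left] at h1
  by_contra hne
  rcases lt_or_gt_of_ne hne with h2 | h2
  · refine hb n _ _ h2 ?_
    simpa [← smul_neg] using neg_mem h1
  · exact hb n _ _ h2 h1

/-- With elimination of quantifiers, every ict-pattern yields an independent sequence of subgroups
defined by linear forms. -/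
theorem exists_indepSubgroups_of_ictPattern {T : (oagLanguage C I).Theory} (hQE : T.HasQE)
    (G : ExpandedOAG.{u, v, w} C I) (hG : (G : Type w) ⊨ T) {m : ℕ} {k : ℕ → ℕ}
    {φ : (i : ℕ) → (oagLanguage C I).Formula (Fin m ⊕ Fin (k i))}
    (a : (i : ℕ) → ℕ → Fin (k i) → G) (c : (ℕ → ℕ) → Fin m → G)
    (hac : ∀ (η : ℕ → ℕ) (i α : ℕ), (φ i).Realize (Sum.elim (c η) (a i α)) ↔ η i = α) :
    ∃ (t : ℕ → Fin m → ℤ) (j : ℕ → I),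
      IndepSubgroups fun n => (G.pred (j n)).comap (linForm G (t n)) := by
  have hdet : ∀ i, ∃ As : List ((Fin m → ℤ) × (ℕ → G) × Option I), ∀ x α β,
      (∀ A ∈ As, SeqAtomHolds G.pred A x α ↔ SeqAtomHolds G.pred A x β) →
        ((φ i).Realize (Sum.elim x (a i α)) ↔ (φ i).Realize (Sum.elim x (a i β))) := fun i => by
    obtain ⟨ψ, hψ, hiff⟩ := hQE _ ((φ i).relabel finSumFinEquiv)
    have hreal : ∀ x α, (φ i).Realize (Sum.elim x (a i α)) ↔
        ψ.Realize (Sum.elim x (a i α) ∘ finSumFinEquiv.symm) := fun x α => by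
      rw [← hiff.realize_iff, Formula.realize_relabel]
      simp [Function.comp_assoc]
    obtain ⟨As, hAs⟩ := G.atomDetermined_of_isQF hψ
    choose b d hbd using fun A : (oagLanguage C I).Term (Fin (m + k i) ⊕ Fin 0) × Option I =>
      G.exists_affine_eq_realize A.1
    let y : (Fin m → G) → ℕ → (Fin (m + k i) ⊕ Fin 0) → G := fun x α =>
      Sum.elim (Sum.elim x (a i α) ∘ finSumFinEquiv.symm) default
    -- Parameters and constants are absorbed into a sequence, leaving a linear form in `x`.
    let u : (oagLanguage C I).Term (Fin (m + k i) ⊕ Fin 0) × Option I → ℕ → G := fun A α =>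
      ∑ l : Fin (k i), b A (Sum.inl (Fin.natAdd m l)) • a i α l + d A
    have hy : ∀ A x α, A.1.realize (y x α) =
        linForm G (fun l => b A (Sum.inl (Fin.castAdd (k i) l))) x + u A α := fun A x α => by
      simp [hbd, y, u, Fin.sum_univ_add, linForm_apply, add_assoc]
    refine ⟨As.map fun A => (fun l => b A (Sum.inl (Fin.castAdd (k i) l)), u A, A.2),
      fun x α β h => ?_⟩
    rw [hreal, hreal]
    refine hAs (y x α) (y x β) fun A hA => ?_
    have h1 := h _ (List.mem_map_of_mem hA)
    obtain ⟨A, o⟩ := A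
    cases o with
    | none =>
      simp only [SeqAtomHolds] at h1
      rwa [← hy (A, none) x α, ← hy (A, none) x β] at h1
    | some j =>
      simp only [SeqAtomHolds] at h1
      rwa [← hy (A, some j) x α, ← hy (A, some j) x β] at h1
  choose As hAs using hdet
  exact exists_indepSubgroups_of_pattern G.pred As
    (fun i x α => (φ i).Realize (Sum.elim x (a i α))) hAs c hac

theorem exists_realizesSubgroupPattern_of_isIctWitness {T : (oagLanguage C I).Theory}
    (hT : T.IsComplete) (G₀ : ExpandedOAG.{u, v, w} C I) (hG₀ : (G₀ : Type w) ⊨ T)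
    (hQE : T.HasQE) {m : ℕ} {k : ℕ → ℕ}
    {φ : (i : ℕ) → (oagLanguage C I).Formula (Fin m ⊕ Fin (k i))} (h : T.IsIctWitness m k φ) :
    ∃ (i : ℕ → I) (ι : ℕ → ℤ), (∀ n, ι n ≠ 0) ∧ RealizesSubgroupPattern T i ι := by
  induction m generalizing k with
  | zero =>
    obtain ⟨M, a, c, hac⟩ := h
    -- An empty tuple cannot distinguish two paths.
    have h0 := (hac (fun _ => 0) 0 0).2 rfl
    rw [Subsingleton.elim (c fun _ => 0) (c fun _ => 1), hac] at h0
    exact absurd h0 one_ne_zero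
  | succ m ih =>
    obtain ⟨G, hG, a, c, hac⟩ := exists_ictWitness_of_isIctWitness hT G₀ hG₀ h
    obtain ⟨t, j, htj⟩ := exists_indepSubgroups_of_ictPattern hQE G hG a c hac
    by_contra hno
    obtain ⟨N, hN⟩ := htj.exists_map_initHom fun i ι hι hind =>
      hno ⟨i, ι, hι, realizesSubgroupPattern_of_indepSubgroups hT G hG hind⟩
    choose θ hθ using fun r => exists_formula_map_initHom G (N r) t j
    exact hno (ih (isIctWitness_of_indepSubgroups G hG hN θ hθ))

/-- A complete theory of expanded ordered abelian groups with elimination of quantifiers is strongly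
dependent exactly if no subgroup pattern is realised. -/
theorem stronglyDependent_iff {T : (oagLanguage C I).Theory} (hT : T.IsComplete)
    (hG : ∃ G : ExpandedOAG.{u, v, w} C I, (G : Type w) ⊨ T) (hQE : T.HasQE) :
    T.StronglyDependent ↔
      ¬ ∃ (i : ℕ → I) (ι : ℕ → ℤ), (∀ n, ι n ≠ 0) ∧ RealizesSubgroupPattern T i ι := by
  obtain ⟨G, hG⟩ := hG
  refine ⟨fun h ⟨i, ι, _, hi⟩ => not_stronglyDependent_of_realizesSubgroupPattern hi h,
    fun h m k φ hφ => h (exists_realizesSubgroupPattern_of_isIctWitness hT G hG hQE hφ)⟩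

end ExpandedOAG

/-! ### A semantic criterion for quantifier elimination -/

namespace ExpandedOAG
open FirstOrder.Language

section QuantifierFree

variable {C : Type u} {I : Type v} (G : ExpandedOAG.{u, v, w} C I) {V : Type*} {n : ℕ}

theorem exists_isQF_atomSet (A : (oagLanguage C I).Term (V ⊕ Fin n) × Option I) :
    ∃ ψ : (oagLanguage C I).BoundedFormula V n, ψ.IsQF ∧
      ∀ x : V ⊕ Fin n → G, ψ.Realize (x ∘ Sum.inl) (x ∘ Sum.inr) ↔ x ∈ G.atomSet A := by
  obtain ⟨t, o⟩ := A
  cases o with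
  | none =>
    refine ⟨(ltSymbol C I).boundedFormula ![zeroTerm, t], (BoundedFormula.IsAtomic.rel _ _).isQF,
      fun x => ?_⟩
    rw [BoundedFormula.realize_rel, Sum.elim_comp_inl_inr]
    rfl
  | some i =>
    refine ⟨(predSymbol C i).boundedFormula ![t], (BoundedFormula.IsAtomic.rel _ _).isQF,
      fun x => ?_⟩
    rw [BoundedFormula.realize_rel, Sum.elim_comp_inl_inr]
    rfl

/-- Case distinction on the first atom. The part of `S` on either side of it need not be determined
by the other atoms, but its saturation is, and adds no point outside `S` on that side. -/
theorem AtomDetermined.exists_isQF {S : Set (V ⊕ Fin n → G)} (h : G.AtomDetermined S) :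
    ∃ ψ : (oagLanguage C I).BoundedFormula V n, ψ.IsQF ∧
      ∀ x : V ⊕ Fin n → G, ψ.Realize (x ∘ Sum.inl) (x ∘ Sum.inr) ↔ x ∈ S := by
  obtain ⟨As, h⟩ := h
  induction As generalizing S with
  | nil =>
    by_cases hS : ∃ y, y ∈ S
    · obtain ⟨y, hy⟩ := hS
      exact ⟨⊤, BoundedFormula.IsQF.top, fun x => by simpa using (h y x (by simp)).1 hy⟩
    · exact ⟨⊥, BoundedFormula.isQF_bot, fun x => by simpa using fun hx => hS ⟨x, hx⟩⟩
  | cons A As ih =>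
    have hdet : ∀ B : Set (V ⊕ Fin n → G), ∀ x y : V ⊕ Fin n → G,
        (∀ A ∈ As, x ∈ G.atomSet A ↔ y ∈ G.atomSet A) →
        (x ∈ {x | ∃ z ∈ B, ∀ A ∈ As, z ∈ G.atomSet A ↔ x ∈ G.atomSet A} ↔
          y ∈ {x | ∃ z ∈ B, ∀ A ∈ As, z ∈ G.atomSet A ↔ x ∈ G.atomSet A}) :=
      fun B x y hxy => exists_congr fun z => and_congr_right fun _ =>
        forall₂_congr fun A hA => by rw [hxy A hA]
    obtain ⟨ψ, hψ, h1⟩ := ih (hdet (S ∩ G.atomSet A))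
    obtain ⟨ψ', hψ', h2⟩ := ih (hdet (S ∩ (G.atomSet A)ᶜ))
    obtain ⟨α, hα, h3⟩ := G.exists_isQF_atomSet A
    refine ⟨(α ⊓ ψ) ⊔ (α.not ⊓ ψ'), (hα.inf hψ).sup (hα.not.inf hψ'), fun x => ?_⟩
    rw [BoundedFormula.realize_sup, BoundedFormula.realize_inf, BoundedFormula.realize_inf,
      BoundedFormula.realize_not, h1, h2, h3]
    constructor
    · rintro (⟨hx, z, hz, hzx⟩ | ⟨hx, z, hz, hzx⟩)
      · exact (h z x (List.forall_mem_cons.2 ⟨iff_of_true hz.2 hx, hzx⟩)).1 hz.1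
      · exact (h z x (List.forall_mem_cons.2 ⟨iff_of_false hz.2 hx, hzx⟩)).1 hz.1
    · intro hx
      by_cases hxA : x ∈ G.atomSet A
      · exact Or.inl ⟨hxA, x, ⟨hx, hxA⟩, fun _ _ => Iff.rfl⟩
      · exact Or.inr ⟨hxA, x, ⟨hx, hxA⟩, fun _ _ => Iff.rfl⟩

instance theory_model : (G : Type w) ⊨ G.theory :=
  inferInstanceAs ((G : Type w) ⊨ (oagLanguage C I).completeTheory G)

theorem isComplete_theory : G.theory.IsComplete :=
  completeTheory.isComplete (oagLanguage C I) G

/-- Equivalences found in `G` alone hold in all models by completeness. -/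
theorem hasQE_theory_of_atomDetermined
    (h : ∀ (n : ℕ) (φ : (oagLanguage C I).Formula (Fin n)),
      G.AtomDetermined {x : Fin n ⊕ Fin 0 → G |
        BoundedFormula.Realize φ (x ∘ Sum.inl) (x ∘ Sum.inr)}) : G.theory.HasQE := by
  intro n φ
  obtain ⟨ψ, hψ, hφψ⟩ := (h n φ).exists_isQF
  refine ⟨ψ, hψ, fun M v xs => ?_⟩
  have h1 : ∀ x : Fin n → G, (Formula.iff φ ψ).Realize x := fun x => by
    rw [Formula.realize_iff]
    have := hφψ (Sum.elim x default)
    rw [Sum.elim_comp_inl, Sum.elim_comp_inr] at this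
    exact this.symm
  have h2 := G.isComplete_theory.forall_realize (M := G) (N := M) h1 v
  rwa [Subsingleton.elim xs default]

end QuantifierFree

end ExpandedOAG

/-! ### Quantifier elimination for Presburger arithmetic -/

/-- Moving `z` close to the nearest of finitely many points, without changing its residue or its
position relative to these points. -/
theorem Int.exists_close_of_finset (E : Finset ℤ) (hE : E.Nonempty) {D : ℕ} (hD : 0 < D) (z : ℤ) :
    ∃ e ∈ E, ∃ j : ℤ, |j| ≤ D ∧ (D : ℤ) ∣ (e + j) - z ∧
      ∀ e' ∈ E, (e' < z ↔ e' < e + j) ∧ (z < e' ↔ e + j < e') := by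
  have hD' : (0 : ℤ) < D := by exact_mod_cast hD
  by_cases hz : z ∈ E
  · exact ⟨z, hz, 0, by simp, by simp, by simp⟩
  by_cases hlt : (E.filter (· < z)).Nonempty
  · obtain ⟨e, he, hmax⟩ := (E.filter (· < z)).exists_max_image id hlt
    rw [Finset.mem_filter] at he
    have h1 := Int.emod_nonneg (z - e - 1) hD'.ne'
    have h2 := Int.emod_lt_of_pos (z - e - 1) hD'
    have h3 := Int.mul_ediv_add_emod (z - e - 1) D
    have h4 : 0 ≤ (z - e - 1) / D := Int.ediv_nonneg (by omega) hD'.le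
    have h5 : 0 ≤ (D : ℤ) * ((z - e - 1) / D) := mul_nonneg hD'.le h4
    -- The representative of `z - e` modulo `D` is taken in `1, …, D`, not `0, …, D - 1`, so that
    -- the new point stays strictly above `e`.
    refine ⟨e, he.1, (z - e - 1) % D + 1, by rw [abs_of_nonneg] <;> omega,
      ⟨- ((z - e - 1) / D), by rw [mul_neg]; omega⟩, fun e' he' => ?_⟩
    by_cases h : e' < z
    · have : e' ≤ e := hmax e' (Finset.mem_filter.2 ⟨he', h⟩)
      omega
    · have : e' ≠ z := fun h => hz (h ▸ he')
      omega
  · have hgt : ∀ e ∈ E, z < e := fun e he => by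
      by_contra h
      have : e ≠ z := fun h => hz (h ▸ he)
      exact hlt ⟨e, Finset.mem_filter.2 ⟨he, by omega⟩⟩
    obtain ⟨e, he, hmin⟩ := E.exists_min_image id hE
    have h0 := hgt e he
    have h1 := Int.emod_nonneg (e - z - 1) hD'.ne'
    have h2 := Int.emod_lt_of_pos (e - z - 1) hD'
    have h3 := Int.mul_ediv_add_emod (e - z - 1) D
    have h4 : 0 ≤ (e - z - 1) / D := Int.ediv_nonneg (by omega) hD'.le
    have h5 : 0 ≤ (D : ℤ) * ((e - z - 1) / D) := mul_nonneg hD'.le h4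
    refine ⟨e, he, - ((e - z - 1) % D + 1), by rw [abs_neg, abs_of_nonneg] <;> omega,
      ⟨(e - z - 1) / D, by omega⟩, fun e' he' => ?_⟩
    have : e ≤ e' := hmin e' he'
    omega

namespace IntWithMultiples
open FirstOrder.Language ExpandedOAG

variable {V : Type*}

/-- The value of a term in `ℤ`. -/
def val (t : (oagLanguage Unit ℕ).Term V) (x : V → ℤ) : ℤ :=
  Term.realize (M := intWithMultiples) x t

theorem val_var (i : V) (x : V → ℤ) : val (Term.var i) x = x i := rfl

theorem val_add (s t : (oagLanguage Unit ℕ).Term V) (x : V → ℤ) :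
    val (addTerm s t) x = val s x + val t x := realize_addTerm intWithMultiples x s t

theorem val_neg (t : (oagLanguage Unit ℕ).Term V) (x : V → ℤ) :
    val (negTerm t) x = - val t x := realize_negTerm intWithMultiples x t

theorem val_zero (x : V → ℤ) : val (zeroTerm : (oagLanguage Unit ℕ).Term V) x = 0 :=
  realize_zeroTerm intWithMultiples x

theorem val_const (x : V → ℤ) : val (constTerm () : (oagLanguage Unit ℕ).Term V) x = 1 := rfl

theorem exists_val_mul (n : ℤ) (t : (oagLanguage Unit ℕ).Term V) :
    ∃ s : (oagLanguage Unit ℕ).Term V, ∀ x, val s x = n * val t x := by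
  obtain ⟨s, hs⟩ := exists_zsmulTerm n t
  exact ⟨s, fun x => (hs intWithMultiples x).trans (smul_eq_mul n (val t x))⟩

theorem mem_atomSet_none (t : (oagLanguage Unit ℕ).Term V) (x : V → ℤ) :
    x ∈ intWithMultiples.atomSet (t, none) ↔ 0 < val t x := Iff.rfl

theorem mem_atomSet_some (t : (oagLanguage Unit ℕ).Term V) (q : ℕ) (x : V → ℤ) :
    x ∈ intWithMultiples.atomSet (t, some q) ↔ (q : ℤ) ∣ val t x :=
  Int.mem_zmultiples_iff

/-- Appending a value for the last variable. -/
def snoc {n : ℕ} (x : V ⊕ Fin n → ℤ) (y : ℤ) : V ⊕ Fin (n + 1) → ℤ :=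
  Sum.elim (x ∘ Sum.inl) (Fin.snoc (x ∘ Sum.inr) y)

theorem exists_val_snoc {n : ℕ} (t : (oagLanguage Unit ℕ).Term (V ⊕ Fin (n + 1))) :
    ∃ (a : ℤ) (s : (oagLanguage Unit ℕ).Term (V ⊕ Fin n)),
      ∀ x y, val t (snoc x y) = a * y + val s x := by
  induction t with
  | var i =>
    rcases i with i | i
    · exact ⟨0, Term.var (Sum.inl i), fun x y => by simp [val_var, snoc]⟩
    · refine Fin.lastCases ?_ (fun i => ?_) i
      · exact ⟨1, zeroTerm, fun x y => by simp [val_var, val_zero, snoc]⟩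
      · exact ⟨0, Term.var (Sum.inr i), fun x y => by simp [val_var, snoc]⟩
  | @func l f ts ih =>
    match l, f, ts, ih with
    | _, OagFunctions.zero, ts, ih =>
      exact ⟨0, zeroTerm, fun x y => by rw [val_zero, zero_mul, zero_add]; rfl⟩
    | _, OagFunctions.const c, ts, ih =>
      exact ⟨0, constTerm (), fun x y => by rw [val_const, zero_mul, zero_add]; rfl⟩
    | _, OagFunctions.neg, ts, ih =>
      obtain ⟨a, s, h⟩ := ih 0
      refine ⟨-a, negTerm s, fun x y => ?_⟩
      change - val (ts 0) _ = _
      rw [h, val_neg]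
      ring
    | _, OagFunctions.add, ts, ih =>
      obtain ⟨a, s, h⟩ := ih 0
      obtain ⟨a', s', h'⟩ := ih 1
      refine ⟨a + a', addTerm s s', fun x y => ?_⟩
      change val (ts 0) _ + val (ts 1) _ = _
      rw [h, h', val_add]
      ring

/-- Since `P_0 = {0}`, its atom amounts to the failure of two inequalities. Without modulus `0`, the
product of the moduli is nonzero. -/
theorem exists_atoms_ne_some_zero {S : Set (V → ℤ)} (h : intWithMultiples.AtomDetermined S) :
    ∃ As : List ((oagLanguage Unit ℕ).Term V × Option ℕ), (∀ A ∈ As, A.2 ≠ some 0) ∧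
      ∀ x y : V → ℤ, (∀ A ∈ As, x ∈ intWithMultiples.atomSet A ↔ y ∈ intWithMultiples.atomSet A) →
        (x ∈ S ↔ y ∈ S) := by
  obtain ⟨As, h⟩ := h
  refine ⟨As.flatMap fun A => if A.2 = some 0 then [(A.1, none), (negTerm A.1, none)] else [A],
    fun A hA => ?_, fun x y hxy => h x y fun A hA => ?_⟩
  · obtain ⟨B, _, hB⟩ := List.mem_flatMap.1 hA
    split_ifs at hB with h0
    · rcases List.mem_cons.1 hB with rfl | hB
      · simp
      · rw [List.mem_singleton.1 hB]; simp
    · rw [List.mem_singleton.1 hB]; exact h0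
  · have hsub := fun B hB => hxy B (List.mem_flatMap.2 ⟨A, hA, hB⟩)
    obtain ⟨t, o⟩ := A
    by_cases h0 : o = some 0
    · subst h0
      rw [if_pos rfl] at hsub
      have h1 := hsub (t, none) (by simp)
      have h2 := hsub (negTerm t, none) (by simp)
      rw [mem_atomSet_none, mem_atomSet_none] at h1 h2
      rw [val_neg, val_neg] at h2
      refine (mem_atomSet_some t 0 x).trans (Iff.trans ?_ (mem_atomSet_some t 0 y).symm)
      rw [Nat.cast_zero, zero_dvd_iff, zero_dvd_iff]
      omega
    · rw [if_neg h0] at hsub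
      exact hsub _ (by simp)

/-- One step of quantifier elimination in Presburger arithmetic. -/
theorem atomDetermined_exists {n : ℕ} {S : Set (V ⊕ Fin (n + 1) → ℤ)}
    (h : intWithMultiples.AtomDetermined S) :
    intWithMultiples.AtomDetermined {x : V ⊕ Fin n → ℤ | ∃ y, snoc x y ∈ S} := by
  classical
  obtain ⟨As, hAs, h⟩ := exists_atoms_ne_some_zero h
  choose a s has using fun A : (oagLanguage Unit ℕ).Term (V ⊕ Fin (n + 1)) × Option ℕ =>
    exists_val_snoc A.1
  choose mul hmul using fun (k : ℤ) (t : (oagLanguage Unit ℕ).Term (V ⊕ Fin n)) =>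
    exists_val_mul k t
  -- a common multiple of the coefficients, and one of the moduli
  let δ : ℕ := (As.map fun A => if a A = 0 then 1 else (a A).natAbs).prod
  let q : ℕ := (As.map fun A => A.2.getD 1).prod
  have hδ : 0 < δ := by
    refine Nat.pos_of_ne_zero (List.prod_ne_zero fun h0 => ?_)
    obtain ⟨A, _, hA⟩ := List.mem_map.1 h0
    split_ifs at hA with h1
    exact h1 (Int.natAbs_eq_zero.1 hA)
  have hq : 0 < q := by
    refine Nat.pos_of_ne_zero (List.prod_ne_zero fun h0 => ?_)
    obtain ⟨⟨t, o⟩, hA, h0⟩ := List.mem_map.1 h0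
    have h1 := hAs _ hA
    cases o with
    | none => simp at h0
    | some r => exact h1 (by simpa using h0)
  have hδ' : (0 : ℤ) < δ := by exact_mod_cast hδ
  have haδ : ∀ A ∈ As, a A ≠ 0 → a A ∣ (δ : ℤ) := fun A hA h0 => by
    rw [← Int.natAbs_dvd_natAbs, Int.natAbs_natCast]
    have := List.dvd_prod (List.mem_map_of_mem
      (f := fun A => if a A = 0 then 1 else (a A).natAbs) hA)
    rwa [if_neg h0] at this
  have hrq : ∀ t r, (t, some r) ∈ As → r ∣ q := fun t r hA =>
    List.dvd_prod (List.mem_map_of_mem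
      (f := fun A : (oagLanguage Unit ℕ).Term (V ⊕ Fin (n + 1)) × Option ℕ => A.2.getD 1) hA)
  -- Moving `δ * y` by multiples of `D` moves `y` by multiples of `q`, which preserves all
  -- congruences.
  let D : ℕ := δ * q
  have hD : 0 < D := Nat.mul_pos hδ hq
  -- end points and test points for `δ * y`
  let es : List ((oagLanguage Unit ℕ).Term (V ⊕ Fin n)) :=
    zeroTerm :: As.map fun A => mul (-(δ / a A)) (s A)
  let js : List ℤ := (List.range (2 * D + 1)).map fun i : ℕ => (i : ℤ) - D
  let cs : List ((oagLanguage Unit ℕ).Term (V ⊕ Fin n)) :=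
    es.flatMap fun e => js.map fun j => addTerm e (mul j (constTerm ()))
  -- The atom at `y = c / δ`, with denominators cleared.
  let sc : (oagLanguage Unit ℕ).Term (V ⊕ Fin n) →
      (oagLanguage Unit ℕ).Term (V ⊕ Fin (n + 1)) × Option ℕ →
      (oagLanguage Unit ℕ).Term (V ⊕ Fin n) × Option ℕ := fun c A =>
    (addTerm (mul (a A) c) (mul δ (s A)), A.2.map (δ * ·))
  have hsc : ∀ c A x y, val c x = δ * y → (x ∈ intWithMultiples.atomSet (sc c A) ↔
      snoc x y ∈ intWithMultiples.atomSet A) := fun c A x y hc => by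
    have hval : val (addTerm (mul (a A) c) (mul δ (s A))) x = δ * val A.1 (snoc x y) := by
      rw [val_add, hmul, hmul, hc, has]
      ring
    obtain ⟨t, o⟩ := A
    cases o with
    | none =>
      refine (mem_atomSet_none _ _).trans (Iff.trans ?_ (mem_atomSet_none _ _).symm)
      rw [hval]
      exact mul_pos_iff_of_pos_left hδ'
    | some r =>
      refine (mem_atomSet_some _ _ _).trans (Iff.trans ?_ (mem_atomSet_some _ _ _).symm)
      rw [hval, Nat.cast_mul]
      exact mul_dvd_mul_iff_left hδ'.ne'
  -- Any `y` can be replaced by a `y'` with `δ * y'` within `D` of an end point, so finitely many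
  -- test terms suffice.
  have htest : ∀ x y, ∃ c ∈ cs, ∃ y', val c x = δ * y' ∧ ∀ A ∈ As,
      (snoc x y ∈ intWithMultiples.atomSet A ↔ snoc x y' ∈ intWithMultiples.atomSet A) := by
    intro x y
    obtain ⟨e, he, j, hj, hdvd, hcmp⟩ := Int.exists_close_of_finset
      (es.map fun e => val e x).toFinset ⟨val zeroTerm x, by simp [es]⟩ hD (δ * y)
    simp only [List.mem_toFinset, List.mem_map, forall_exists_index, and_imp,
      forall_apply_eq_imp_iff₂] at he hcmp
    obtain ⟨e, he, rfl⟩ := he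
    have hjs : j ∈ js := by
      rw [abs_le] at hj
      exact List.mem_map.2 ⟨(j + D).toNat, List.mem_range.2 (by omega), by omega⟩
    have hdvd' : (δ : ℤ) ∣ val e x + j := by
      have h1 : (δ : ℤ) ∣ (D : ℤ) := ⟨q, by simp [D]⟩
      have h2 := dvd_add (h1.trans hdvd) (Dvd.intro y rfl)
      rwa [sub_add_cancel] at h2
    obtain ⟨y', hy'⟩ := hdvd'
    refine ⟨_, List.mem_flatMap.2 ⟨e, he, List.mem_map_of_mem hjs⟩, y', ?_, ?_⟩
    · rw [val_add, hmul, val_const, mul_one, hy']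
    rintro ⟨t, o⟩ hA
    rw [hy'] at hcmp hdvd
    cases o with
    | none =>
      rw [mem_atomSet_none, mem_atomSet_none, has (t, none), has (t, none)]
      by_cases h0 : a (t, none) = 0
      · rw [h0, zero_mul, zero_mul]
      obtain ⟨d, hd⟩ := haδ _ hA h0
      have h1 := hcmp (mul (-(δ / a (t, none))) (s (t, none)))
        (List.mem_cons_of_mem _ (List.mem_map_of_mem
          (f := fun A => mul (-(δ / a A)) (s A)) hA))
      rw [hmul, hd, Int.mul_ediv_cancel_left _ h0] at h1
      have h2 : ∀ y, a (t, none) * d * y - -d * val (s (t, none)) x =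
          d * (a (t, none) * y + val (s (t, none)) x) := fun y => by ring
      have h3 : d ≠ 0 := fun h => by rw [h, mul_zero] at hd; omega
      rcases lt_or_gt_of_ne h3 with h3 | h3
      · rw [← sub_neg (b := -d * _), ← sub_neg (b := -d * _), h2, h2] at h1
        simpa only [mul_neg_iff, h3, h3.not_gt, true_and, false_and, false_or] using h1.2
      · rw [← sub_pos (b := -d * _), ← sub_pos (b := -d * _), h2, h2] at h1
        simpa only [mul_pos_iff_of_pos_left h3] using h1.1
    | some r =>
      rw [mem_atomSet_some, mem_atomSet_some, has (t, some r), has (t, some r)]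
      have h1 : ((δ : ℤ) * r) ∣ δ * (y' - y) := by
        rw [mul_sub]
        refine dvd_trans ?_ hdvd
        simp only [D, Nat.cast_mul]
        exact mul_dvd_mul_left _ (Int.natCast_dvd_natCast.2 (hrq t r hA))
      have h2 : (r : ℤ) ∣ y' - y := (mul_dvd_mul_iff_left hδ'.ne').1 h1
      have h3 : a (t, some r) * y' + val (s (t, some r)) x =
          (a (t, some r) * y + val (s (t, some r)) x) + a (t, some r) * (y' - y) := by ring
      rw [h3, dvd_add_left (h2.mul_left _)]
  refine ⟨cs.flatMap fun c => (c, some δ) :: As.map (sc c), ?_⟩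
  have hone : ∀ x x' : V ⊕ Fin n → ℤ, (∀ A ∈ cs.flatMap fun c => (c, some δ) :: As.map (sc c),
      x ∈ intWithMultiples.atomSet A ↔ x' ∈ intWithMultiples.atomSet A) →
      (∃ y, snoc x y ∈ S) → ∃ y, snoc x' y ∈ S := by
    rintro x x' hxx' ⟨y, hy⟩
    obtain ⟨c, hc, y', hcy', hyy'⟩ := htest x y
    have h1 := fun A hA => hxx' A (List.mem_flatMap.2 ⟨c, hc, hA⟩)
    have h2 := h1 (c, some δ) (by simp)
    rw [mem_atomSet_some, mem_atomSet_some] at h2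
    obtain ⟨y'', hy''⟩ := h2.1 ⟨y', hcy'⟩
    refine ⟨y'', (h _ _ fun A hA => ?_).1 hy⟩
    rw [hyy' A hA, ← hsc c A x y' hcy', ← hsc c A x' y'' hy'']
    exact h1 _ (List.mem_cons_of_mem _ (List.mem_map_of_mem hA))
  exact fun x x' hxx' => ⟨hone x x' hxx', hone x' x fun A hA => (hxx' A hA).symm⟩

theorem atomDetermined_realize {n : ℕ} (φ : (oagLanguage Unit ℕ).BoundedFormula V n) :
    intWithMultiples.AtomDetermined {x : V ⊕ Fin n → intWithMultiples |
      φ.Realize (x ∘ Sum.inl) (x ∘ Sum.inr)} := by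
  induction φ with
  | falsum => exact ⟨[], fun x y _ => Iff.rfl⟩
  | equal s t => exact atomDetermined_of_isAtomic _ (BoundedFormula.IsAtomic.equal s t)
  | rel R ts => exact atomDetermined_of_isAtomic _ (BoundedFormula.IsAtomic.rel R ts)
  | imp _ _ ih ih' => exact ih.imp _ ih'
  | all φ ih =>
    have h := (atomDetermined_exists (ih.not _)).not
    refine (congrArg intWithMultiples.AtomDetermined ?_).mp h
    ext x
    have h1 : (∃ y : ℤ, ¬ φ.Realize (M := intWithMultiples) (x ∘ Sum.inl)
        (Fin.snoc (x ∘ Sum.inr) y)) ↔ ¬ (φ.all).Realize (x ∘ Sum.inl) (x ∘ Sum.inr) :=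
      not_forall.symm
    exact (not_congr h1).trans not_not

theorem hasQE : intWithMultiples.theory.HasQE :=
  hasQE_theory_of_atomDetermined _ fun _ φ => atomDetermined_realize φ

end IntWithMultiples

/-! ### Strong dependence of the integers with multiples -/

namespace IntWithMultiples
open FirstOrder.Language ExpandedOAG

/-- The formula saying that two of the `k + 1` variables are congruent modulo `P_k`. -/
noncomputable def congruentFormula (k : ℕ) : (oagLanguage Unit ℕ).Formula (Fin (k + 1)) :=
  Formula.iSup fun p : {p : Fin (k + 1) × Fin (k + 1) // p.1 ≠ p.2} =>
    predFormula k (addTerm (Term.var p.1.1) (negTerm (Term.var p.1.2)))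

theorem realize_congruentFormula (G : ExpandedOAG.{0, 0, w} Unit ℕ) (k : ℕ)
    (x : Fin (k + 1) → G) :
    (congruentFormula k).Realize x ↔ ∃ a b, a ≠ b ∧ x a - x b ∈ G.pred k := by
  rw [congruentFormula, Formula.realize_iSup]
  simp [sub_eq_add_neg]

section Models

variable (G : ExpandedOAG.{0, 0, w} Unit ℕ) [(G : Type w) ⊨ intWithMultiples.theory]

theorem eq_zero_of_mem_pred_zero {x : G} (hx : x ∈ G.pred 0) : x = 0 := by
  have h : ∀ y : Fin 1 → intWithMultiples, ((predFormula 0 (Term.var 0)).imp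
      ((Term.var 0).equal (zeroTerm : (oagLanguage Unit ℕ).Term (Fin 1)))).Realize y := fun y => by
    rw [Formula.realize_imp, realize_predFormula, Formula.realize_equal, realize_zeroTerm,
      Term.realize_var]
    intro hy
    exact zero_dvd_iff.1 (Int.mem_zmultiples_iff.1 hy)
  have := (isComplete_theory intWithMultiples).forall_realize (N := G) h ![x]
  rw [Formula.realize_imp, realize_predFormula, Formula.realize_equal, realize_zeroTerm,
    Term.realize_var] at this
  exact this hx

/-- Pigeonhole in `ZMod k`; for fixed `k` this is a first-order statement and transfers from `ℤ`. -/
theorem exists_ne_sub_mem_pred {k : ℕ} (hk : k ≠ 0) (x : Fin (k + 1) → G) :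
    ∃ a b, a ≠ b ∧ x a - x b ∈ G.pred k := by
  have h : ∀ x : Fin (k + 1) → intWithMultiples,
      ∃ a b, a ≠ b ∧ x a - x b ∈ intWithMultiples.pred k := by
    intro x
    have : NeZero k := ⟨hk⟩
    obtain ⟨a, b, hab, h⟩ := Fintype.exists_ne_map_eq_of_card_lt
      (fun a => ((show ℤ from x a : ℤ) : ZMod k)) (by simp [ZMod.card])
    refine ⟨b, a, hab.symm, Int.mem_zmultiples_iff.2 ?_⟩
    exact (ZMod.intCast_eq_intCast_iff_dvd_sub _ _ _).1 h
  rw [← realize_congruentFormula]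
  refine (isComplete_theory intWithMultiples).forall_realize (M := intWithMultiples) (N := G)
    (fun y => ?_) x
  exact (realize_congruentFormula _ k y).2 (h y)

end Models

theorem stronglyDependent : intWithMultiples.theory.StronglyDependent := by
  rw [stronglyDependent_iff (isComplete_theory _) ⟨intWithMultiples, inferInstance⟩ hasQE]
  rintro ⟨i, ι, hι, G, hG, b, hb, hc⟩
  have hi : ∀ n, i n = 0 := fun n => by
    by_contra hn
    obtain ⟨a, a', hne, hmem⟩ := exists_ne_sub_mem_pred G hn fun l => b n l
    rcases lt_or_gt_of_ne hne with h | h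
    · refine hb n a a' h ((G.pred (i n)).zsmul_mem ?_ _)
      simpa using neg_mem hmem
    · exact hb n a' a h ((G.pred (i n)).zsmul_mem hmem _)
  -- With `P_0` trivial and no torsion, `c` equals `b n (η n)` for all `n` at once; rows `0` and `1`
  -- already conflict.
  have hc' : ∀ η : ℕ → ℕ, ∃ c : G, ∀ n, c = b n (η n) := fun η => by
    obtain ⟨c, hc⟩ := hc η
    refine ⟨c, fun n => ?_⟩
    have h := hc n
    rw [hi] at h
    exact sub_eq_zero.1 ((smul_eq_zero.1 (eq_zero_of_mem_pred_zero G h)).resolve_left (hι n))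
  obtain ⟨c, hc0⟩ := hc' fun _ => 0
  obtain ⟨c', hc1⟩ := hc' fun n => n
  refine hb 1 0 1 one_pos ?_
  rw [← hc0 1, ← hc1 1, hc0 0, hc1 0, sub_self, smul_zero]
  exact zero_mem _

end IntWithMultiples

/-! ### Passing to the reduct -/

namespace IntOrderedGroup
open FirstOrder.Language ExpandedOAG

/-- The inclusion of the language of ordered abelian groups into an expansion. -/
def inclusion (C : Type u) (I : Type v) : oagLanguage Empty Empty →ᴸ oagLanguage C I where
  onFunction _ f := match f with
    | OagFunctions.zero => OagFunctions.zero
    | OagFunctions.const c => c.elim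
    | OagFunctions.neg => OagFunctions.neg
    | OagFunctions.add => OagFunctions.add
  onRelation _ r := match r with
    | OagRelations.lt => OagRelations.lt
    | OagRelations.pred i => i.elim

theorem realize_inclusion {V : Type*} (φ : (oagLanguage Empty Empty).Formula V) (x : V → ℤ) :
    Formula.Realize (M := intWithMultiples) ((inclusion Unit ℕ).onFormula φ) x ↔
      Formula.Realize (M := intOrderedGroup) φ x := by
  let S : (oagLanguage Empty Empty).Structure intWithMultiples := intOrderedGroup.toStructure
  have : (inclusion Unit ℕ).IsExpansionOn intWithMultiples :=
    { map_onFunction := fun {n} f x => match n, f, x with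
        | _, OagFunctions.zero, _ => rfl
        | _, OagFunctions.const c, _ => c.elim
        | _, OagFunctions.neg, _ => rfl
        | _, OagFunctions.add, _ => rfl
      map_onRelation := fun {n} r x => match n, r, x with
        | _, OagRelations.lt, _ => rfl
        | _, OagRelations.pred i, _ => i.elim }
  exact LHom.realize_onFormula (M := intWithMultiples) (inclusion Unit ℕ) φ

/-- Finite parts of an ict-pattern are realised in `ℤ` itself, where the formulas keep their meaning
in the expansion; compactness then gives a pattern for the expansion. -/
theorem stronglyDependent : intOrderedGroup.theory.StronglyDependent := by
  intro m k φ h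
  refine IntWithMultiples.stronglyDependent m k (fun i => (inclusion Unit ℕ).onFormula (φ i))
    (Theory.isIctWitness_of_finite intWithMultiples fun F => ?_)
  obtain ⟨a, c, hac⟩ := (isComplete_theory intOrderedGroup).exists_finite_ictPattern h
    intOrderedGroup F
  exact ⟨a, c, fun p hp => (realize_inclusion _ _).trans (hac p hp)⟩

end IntOrderedGroup

theorem claim1p8 :
    (∀ (C : Type u) (I : Type v) (T : (oagLanguage C I).Theory),
      T.IsComplete →
      (∃ G : ExpandedOAG.{u, v, w} C I, (G : Type w) ⊨ T) →
      T.HasQE →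
      (T.StronglyDependent ↔
        ¬ ∃ (i : ℕ → I) (ι : ℕ → ℤ), (∀ n, ι n ≠ 0) ∧ RealizesSubgroupPattern T i ι)) ∧
    (intWithMultiples.theory.HasQE ∧
      intWithMultiples.theory.StronglyDependent ∧
      intOrderedGroup.theory.StronglyDependent) :=
  ⟨fun _ _ _ hT hG hQE => ExpandedOAG.stronglyDependent_iff hT hG hQE, IntWithMultiples.hasQE,
    IntWithMultiples.stronglyDependent, IntOrderedGroup.stronglyDependent⟩
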